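/- Let $p<N$ be natural numbers and consider the location model $Y_i=\theta+\varepsilon_i$, $1\le i\le N$, in $\mathbb{R}^p$, with $\theta\in\mathbb{R}^p$ unknown. For every positive definite $p\times p$ scale matrix $\Sigma$ the errors $(\varepsilon_1,\dots,\varepsilon_N)$ have a joint elliptically contoured law with Lebesgue density $$|\Sigma|^{-N/2}\,g\Big(\mathrm{tr}\,\Sigma^{-1}\sum_{i=1}^N\varepsilon_i\varepsilon_i'\Big),\qquad g\ge 0 \text{ measurable, not depending on } (\theta,\Sigma).$$ Assume that this law belongs to the following sub-class: there is a signed measure $W$ on $(0,\infty)$, with Jordan decomposition $W=W^+-W^-$, such that for every $\Sigma$ each $\varepsilon_i$ has the probability density $$f(x)=\int_0^\infty \phi_{N_p(0,t^{-1}\Sigma)}(x)\,W(dt),\qquad \int_0^\infty t^{-1}\,W^{+}(dt)<\infty,\quad \int_0^\infty t^{-1}\,W^{-}(dt)<\infty,$$ where $\phi_{N_p(0,V)}$ is the density of the normal law $N_p(0,V)$. Put $\hat\theta=\bar Y=\frac1N\sum_{i=1}^N Y_i$ and $S=\sum_{i=1}^N(Y_i-\bar Y)(Y_i-\bar Y)'$,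 and let the loss be $L(\delta;\theta)=N(\delta-\theta)'\Sigma^{-1}(\delta-\theta)$. Let $r:[0,\infty)\to[0,\infty)$ be absolutely continuous on every interval $[0,b]$ and such that (i) $r$ is non-decreasing, (ii) $r\le \dfrac{2(p-2)}{N(N-p+2)}$. Then the estimator $$\delta_r(\hat\theta)=\left[1-\frac{r(\hat\theta'S^{-1}\hat\theta)}{\hat\theta'S^{-1}\hat\theta}\right]\hat\theta$$ is minimax: among all measurable estimators $\delta$ of $\theta$ based on $(Y_1,\dots,Y_N)$ it has the smallest maximal risk $\sup E[L(\delta;\theta)]$. This holds when the supremum is taken over all $\theta\in\mathbb{R}^p$ for any fixed $\Sigma$, and also when it is taken over all pairs $(\theta,\Sigma)$ with $\Sigma$ positive definite. -/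

import Mathlib

open MeasureTheory Matrix

noncomputable section

namespace EllipticalLocation

/-- The data `y = (y₁, …, y_N)`, a sample of `N` vectors of `ℝ^p`
(all measures below are taken with respect to Lebesgue measure `volume` on it). -/
abbrev Sample (N p : ℕ) : Type := Fin N → Fin p → ℝ

/-- Density at `x` of the centred normal distribution on `ℝ^p` with covariance matrix `V`. -/
def normalPDF {p : ℕ} (V : Matrix (Fin p) (Fin p) ℝ) (x : Fin p → ℝ) : ℝ :=
  (Real.sqrt ((2 * Real.pi) ^ p * V.det))⁻¹ * Real.exp (-(x ⬝ᵥ (V⁻¹ *ᵥ x)) / 2)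

/-- The signed scale mixture of normals `x ↦ ∫_{(0,∞)} φ_{N_p(0, t⁻¹ V)}(x) W(dt)`, where the
integral against the signed measure `W` is the difference of the integrals against the two parts
of its Jordan decomposition. -/
def mixturePDF {p : ℕ} (W : SignedMeasure (Set.Ioi (0 : ℝ))) (V : Matrix (Fin p) (Fin p) ℝ)
    (x : Fin p → ℝ) : ℝ :=
  (∫ t : Set.Ioi (0 : ℝ), normalPDF ((t : ℝ)⁻¹ • V) x ∂W.toJordanDecomposition.posPart) -
    ∫ t : Set.Ioi (0 : ℝ), normalPDF ((t : ℝ)⁻¹ • V) x ∂W.toJordanDecomposition.negPart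

/-- The joint elliptically contoured law of the errors `(ε₁, …, ε_N)` with scale matrix `V` and
density generator `g`: its Lebesgue density is `|V|^{-N/2} g(tr(V⁻¹ ∑ᵢ εᵢ εᵢ'))`
(the normalizing constant is part of `g`). -/
def errorLaw {N p : ℕ} (g : ℝ → ℝ) (V : Matrix (Fin p) (Fin p) ℝ) : Measure (Sample N p) :=
  volume.withDensity fun e =>
    ENNReal.ofReal (V.det ^ (-(N : ℝ) / 2) * g (V⁻¹ * ∑ i, vecMulVec (e i) (e i)).trace)

/-- The generator `g` defines, for every scale matrix, a joint elliptical law of `N` errors in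
`ℝ^p`, and this law belongs to the sub-class generated by the signed measure `W`: each error has
the signed normal mixture as its probability density, and `t⁻¹` is integrable with respect to
both the positive and the negative part of `W`. -/
structure InSubclass (N p : ℕ) (g : ℝ → ℝ) (W : SignedMeasure (Set.Ioi (0 : ℝ))) : Prop where
  measurable_generator : Measurable g
  generator_nonneg : ∀ u, 0 ≤ u → 0 ≤ g u
  isProbabilityMeasure : ∀ V : Matrix (Fin p) (Fin p) ℝ, V.PosDef →
    IsProbabilityMeasure (errorLaw (N := N) g V)
  mixturePDF_nonneg : ∀ V : Matrix (Fin p) (Fin p) ℝ, V.PosDef →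
    ∀ᵐ x : Fin p → ℝ, 0 ≤ mixturePDF W V x
  component_law : ∀ V : Matrix (Fin p) (Fin p) ℝ, V.PosDef → ∀ i : Fin N,
    (errorLaw (N := N) g V).map (fun e => e i) =
      volume.withDensity fun x => ENNReal.ofReal (mixturePDF W V x)
  integrable_posPart :
    Integrable (fun t : Set.Ioi (0 : ℝ) => (t : ℝ)⁻¹) W.toJordanDecomposition.posPart
  integrable_negPart :
    Integrable (fun t : Set.Ioi (0 : ℝ) => (t : ℝ)⁻¹) W.toJordanDecomposition.negPart

/-- The law of the observations `Yᵢ = θ + εᵢ`. -/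
def dataLaw {N p : ℕ} (g : ℝ → ℝ) (V : Matrix (Fin p) (Fin p) ℝ) (θ : Fin p → ℝ) :
    Measure (Sample N p) :=
  (errorLaw g V).map fun e i => θ + e i

/-- The loss `N (d - θ)' V⁻¹ (d - θ)`. -/
def loss {p : ℕ} (N : ℕ) (V : Matrix (Fin p) (Fin p) ℝ) (d θ : Fin p → ℝ) : ℝ :=
  N * ((d - θ) ⬝ᵥ (V⁻¹ *ᵥ (d - θ)))

/-- The risk (expected loss) of the estimator `δ` at `(θ, V)`; the loss is nonnegative for
positive definite `V`, so its expectation is always meaningful in `[0, ∞]`. -/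
def risk {N p : ℕ} (g : ℝ → ℝ) (δ : Sample N p → Fin p → ℝ) (θ : Fin p → ℝ)
    (V : Matrix (Fin p) (Fin p) ℝ) : ENNReal :=
  ∫⁻ y, ENNReal.ofReal (loss N V (δ y) θ) ∂dataLaw g V θ

/-- The estimator `δ` is minimax for the risk function `R` over the parameter space `Θ`: no
estimator has a smaller maximal risk. -/
def IsMinimax {N p : ℕ} {Θ : Type*} (R : (Sample N p → Fin p → ℝ) → Θ → ENNReal)
    (δ : Sample N p → Fin p → ℝ) : Prop :=
  Measurable δ ∧ ∀ δ' : Sample N p → Fin p → ℝ, Measurable δ' → ⨆ ϑ, R δ ϑ ≤ ⨆ ϑ, R δ' ϑ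

/-- The sample mean `ȳ`. -/
def sampleMean {N p : ℕ} (y : Sample N p) : Fin p → ℝ := (N : ℝ)⁻¹ • ∑ i, y i

/-- The scatter matrix `S = ∑ᵢ (yᵢ - ȳ)(yᵢ - ȳ)'`. -/
def scatter {N p : ℕ} (y : Sample N p) : Matrix (Fin p) (Fin p) ℝ :=
  ∑ i, vecMulVec (y i - sampleMean y) (y i - sampleMean y)

/-- The statistic `ȳ' S⁻¹ ȳ`. -/
def statF {N p : ℕ} (y : Sample N p) : ℝ := sampleMean y ⬝ᵥ ((scatter y)⁻¹ *ᵥ sampleMean y)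

/-- The Baranchik-type shrinkage estimator `[1 - r(ȳ'S⁻¹ȳ) / (ȳ'S⁻¹ȳ)] ȳ`. -/
def baranchik {N p : ℕ} (r : ℝ → ℝ) (y : Sample N p) : Fin p → ℝ :=
  (1 - r (statF y) / statF y) • sampleMean y

end EllipticalLocation

end

namespace EllipticalLocation

open Set ENNReal

/-! Minimaxity splits into two facts: the sample mean has a risk independent of θ which no
estimator's maximal risk can undercut, and the shrinkage estimator has, at every (θ, Σ), at most the
risk of the sample mean.

Lower bound. The reflection e ↦ e − 2ē preserves the error law, fixes the deviations and changes the
sign of ē, so under a flat prior on θ the parallelogram law prevents any estimator from beating the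
mean. The flat prior is improper: the loss is truncated to ‖ē‖ ≤ K, θ ranges over a growing ball,
the ratio of the ball volumes tends to 1, and then K → ∞
(`lintegral_quadLoss_sampleMean_le_iSup_risk`).

Domination. An orthogonal change of the observations and a square root of Σ lead to x ∈ ℝ^p and n =
N − 1 rows U, with density proportional to γ(‖x − μ‖² + ‖U‖²). Put F = x'(U'U)⁻¹x = N·Ȳ'S⁻¹Ȳ, ρ(s) =
N r(s/N), ψ = ρ(F)/F and Γ(s) = ½∫_s^∞ γ. Shrinking changes the risk by −2∫ψ x·(x − μ)γ + ∫ψ²‖x‖²γ,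
and both terms are compared with integrals against Γ: (p − 2)∫ψΓ ≤ ∫ψ x·(x − μ)γ, by integration
along rays in x, where monotonicity of ρ lets a nonnegative term be dropped
(`radial_field_inequality`); ∫ψ²‖x‖²γ ≤ (n − p + 3)∫(ρ²/F)Γ, by dilating in U the residual of one
column regressed on the others (`scatter_field_inequality`). The bound on r reads ρ ≤ 2(p − 2)/(n −
p + 3), which makes the change nonpositive (`shrinkage_risk_le`). Both inequalities are Tonelli
arguments for nonnegative integrals, with superlevel sets or dilations in place of derivatives;
finite second moments, supplied by ∫t⁻¹dW⁺ < ∞, serve to cancel the cross term. -/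

/-! ### One-dimensional tails of the density generator. -/

theorem lintegral_quadratic_substitution (γ : ℝ → ℝ≥0∞) {b v l τ : ℝ} (hv : 0 < v) (hτ : l ≤ τ) :
    ∫⁻ t in Ioi τ, ENNReal.ofReal (2 * (v * (t - l))) * γ (b + v * (t - l) ^ 2)
      = ∫⁻ s in Ioi (b + v * (τ - l) ^ 2), γ s := by
  have himg : (fun t => b + v * (t - l) ^ 2) '' Ioi τ = Ioi (b + v * (τ - l) ^ 2) := by
    ext s
    constructor
    · rintro ⟨t, ht, rfl⟩
      have ht' : τ < t := ht
      have h1 : (τ - l) ^ 2 < (t - l) ^ 2 := by nlinarith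
      have h2 := mul_lt_mul_of_pos_left h1 hv
      simpa using h2
    · intro hs
      have hs' : b + v * (τ - l) ^ 2 < s := hs
      have h0 : (τ - l) ^ 2 < (s - b) / v := by
        rw [lt_div_iff₀ hv]; linarith
      refine ⟨l + Real.sqrt ((s - b) / v), ?_, ?_⟩
      · have := Real.lt_sqrt_of_sq_lt h0
        simp only [mem_Ioi]; linarith
      · have h3 : Real.sqrt ((s - b) / v) ^ 2 = (s - b) / v :=
          Real.sq_sqrt (le_trans (sq_nonneg _) h0.le)
        simp only [add_sub_cancel_left, h3]
        field_simp; ring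
  rw [← himg, lintegral_image_eq_lintegral_abs_deriv_mul (f' := fun t => 2 * (v * (t - l)))
    measurableSet_Ioi]
  · refine setLIntegral_congr_fun measurableSet_Ioi fun t ht => ?_
    have ht' : τ < t := ht
    have : 0 ≤ 2 * (v * (t - l)) := by
      have : 0 ≤ t - l := by linarith
      positivity
    simp only [abs_of_nonneg this]
  · intro t _
    have h := ((((hasDerivAt_id t).sub_const l).pow 2).const_mul v).const_add b
    refine (h.congr_deriv ?_).hasDerivWithinAt
    simp; ring
  · intro t ht u hu h
    have ht' : τ < t := ht
    have hu' : τ < u := hu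
    have h' : v * (t - l) ^ 2 = v * (u - l) ^ 2 := by simpa using h
    have h2 := mul_left_cancel₀ hv.ne' h'
    have h3 := (sq_eq_sq₀ (by linarith : 0 ≤ t - l) (by linarith : 0 ≤ u - l)).1 h2
    linarith

/-- Half of the mass of `γ` above `s`. -/
noncomputable def halfTail (γ : ℝ → ℝ≥0∞) (s : ℝ) : ℝ≥0∞ := 2⁻¹ * ∫⁻ u in Ioi s, γ u

theorem halfTail_antitone (γ : ℝ → ℝ≥0∞) : Antitone (halfTail γ) := fun _ _ h =>
  mul_le_mul_right (lintegral_mono_set (Ioi_subset_Ioi h)) _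

theorem measurable_halfTail (γ : ℝ → ℝ≥0∞) : Measurable (halfTail γ) :=
  (halfTail_antitone γ).measurable

/-- The chain rule produces the factor 2v(t − l); the half in `halfTail` absorbs the 2. -/
theorem lintegral_quadratic_eq_halfTail (γ : ℝ → ℝ≥0∞) {b v l τ : ℝ} (hv : 0 < v)
    (hτ : l ≤ τ) :
    ∫⁻ t in Ioi τ, ENNReal.ofReal (v * (t - l)) * γ (b + v * (t - l) ^ 2)
      = halfTail γ (b + v * (τ - l) ^ 2) := by
  rw [halfTail, ← lintegral_quadratic_substitution γ hv hτ, ← lintegral_const_mul' _ _ (by simp)]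
  congr 1; ext t
  rw [ENNReal.ofReal_mul (p := 2) (by norm_num), mul_assoc, ← mul_assoc 2⁻¹,
    ENNReal.ofReal_ofNat, ENNReal.inv_mul_cancel (by simp) (by simp), one_mul]

/-- Formally, minus the half tail is an antiderivative of v(t − l)γ(b + v(t − l)²). Positive and
negative parts are kept on separate sides to avoid ∞ − ∞. -/
theorem quadratic_tail_le {γ : ℝ → ℝ≥0∞} (hγ : Measurable γ) {b v : ℝ} (hv : 0 < v) (l σ : ℝ) :
    (∫⁻ t in Ioi σ, ENNReal.ofReal (-(v * (t - l))) * γ (b + v * (t - l) ^ 2))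
        + halfTail γ (b + v * (σ - l) ^ 2)
      ≤ ∫⁻ t in Ioi σ, ENNReal.ofReal (v * (t - l)) * γ (b + v * (t - l) ^ 2) := by
  rcases le_or_gt l σ with h | h
  · rw [lintegral_quadratic_eq_halfTail γ hv h]
    have : ∫⁻ t in Ioi σ, ENNReal.ofReal (-(v * (t - l))) * γ (b + v * (t - l) ^ 2) = 0 := by
      rw [setLIntegral_congr_fun (g := fun _ => 0) measurableSet_Ioi]
      · simp
      · intro t ht
        have ht' : σ < t := ht
        have : 0 ≤ v * (t - l) := mul_nonneg hv.le (by linarith)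
        simp [ENNReal.ofReal_of_nonpos (neg_nonpos.2 this)]
    rw [this, zero_add]
  -- For `σ < l`, the reflection t ↦ 2l − t turns the negative part into the positive part on `Iio
  -- (2 * l - σ)`, and the half tail starts at the mirror point `2 * l - σ`. Together they fit into
  -- the positive part on `Ioi σ`, which vanishes below `l`.
  · have hσ : (σ - l) ^ 2 = (2 * l - σ - l) ^ 2 := by ring
    rw [hσ, ← lintegral_quadratic_eq_halfTail γ hv (by linarith)]
    have hq : Measurable fun t : ℝ =>
      ENNReal.ofReal (v * (t - l)) * γ (b + v * (t - l) ^ 2) := by fun_prop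
    have hrefl : ∫⁻ t in Ioi σ, ENNReal.ofReal (-(v * (t - l))) * γ (b + v * (t - l) ^ 2)
        = ∫⁻ t in Iio (2 * l - σ), ENNReal.ofReal (v * (t - l)) * γ (b + v * (t - l) ^ 2) := by
      rw [← lintegral_indicator measurableSet_Ioi, ← lintegral_indicator measurableSet_Iio,
        ← lintegral_sub_left_eq_self _ (2 * l)]
      congr 1; ext t
      by_cases ht : t < 2 * l - σ
      · rw [indicator_of_mem (by simp; linarith), indicator_of_mem (by simpa using ht)]
        congr 3 <;> ring
      · rw [indicator_of_notMem (by simp; linarith), indicator_of_notMem (by simpa using ht)]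
    rw [hrefl, ← lintegral_indicator measurableSet_Ioi, ← lintegral_indicator measurableSet_Ioi,
      ← lintegral_indicator measurableSet_Iio, ← lintegral_add_left (hq.indicator measurableSet_Iio)]
    refine lintegral_mono fun t => ?_
    by_cases h1 : t < 2 * l - σ
    · rw [indicator_of_mem (by simpa using h1),
        indicator_of_notMem (by simpa using h1.le), add_zero]
      by_cases h2 : σ < t
      · rw [indicator_of_mem (by simpa using h2)]
      · rw [ENNReal.ofReal_of_nonpos (mul_nonpos_of_nonneg_of_nonpos hv.le (by linarith))]
        simp
    · rw [indicator_of_notMem (by simpa using h1), zero_add]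
      by_cases h2 : 2 * l - σ < t
      · rw [indicator_of_mem (by simpa using h2), indicator_of_mem (by simp; linarith)]
      · rw [indicator_of_notMem (by simpa using h2)]
        simp

/-! ### Tail inequalities with monotone weights. -/

theorem ofReal_pow_eq_add_lintegral {k : ℕ} {a t : ℝ} (ha : 0 ≤ a) (hat : a ≤ t) :
    ENNReal.ofReal (t ^ k)
      = ENNReal.ofReal (a ^ k) + ∫⁻ s in Ioo a t, ENNReal.ofReal (k * s ^ (k - 1)) := by
  have h1 : ∫ s in a..t, (k * s ^ (k - 1) : ℝ) = t ^ k - a ^ k :=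
    intervalIntegral.integral_eq_sub_of_hasDerivAt (f := fun s => s ^ k)
      (fun s _ => hasDerivAt_pow k s)
      ((by fun_prop : Continuous fun s : ℝ => (k * s ^ (k - 1) : ℝ)).intervalIntegrable _ _)
  rw [Measure.restrict_congr_set Ioo_ae_eq_Ioc, ← ofReal_integral_eq_lintegral_ofReal,
    ← intervalIntegral.integral_of_le hat, h1, ← ENNReal.ofReal_add (by positivity)]
  · congr 1; ring
  · rw [sub_nonneg]; exact pow_le_pow_left₀ ha hat _
  · exact ((by fun_prop : Continuous fun s : ℝ => (k * s ^ (k - 1) : ℝ)).intervalIntegrable a t).1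
  · filter_upwards [ae_restrict_mem measurableSet_Ioc] with s hs
    have : 0 ≤ s := ha.trans hs.1.le
    positivity

/-- Integration by parts in Tonelli form: t^k is a^k plus the integral of its derivative over (a,
t), and the order of integration is exchanged. -/
theorem lintegral_pow_mul_tail {f : ℝ → ℝ≥0∞} (hf : Measurable f) (k : ℕ) {a : ℝ} (ha : 0 ≤ a) :
    ∫⁻ t in Ioi a, ENNReal.ofReal (t ^ k) * f t
      = ENNReal.ofReal (a ^ k) * (∫⁻ t in Ioi a, f t)
        + ∫⁻ s in Ioi a, ENNReal.ofReal (k * s ^ (k - 1)) * ∫⁻ t in Ioi s, f t := by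
  have h1 : ∀ t ∈ Ioi a, ENNReal.ofReal (t ^ k) * f t = ENNReal.ofReal (a ^ k) * f t
      + ∫⁻ s in Ioi a, (Iio t).indicator (fun s => ENNReal.ofReal (k * s ^ (k - 1)) * f t) s := by
    intro t ht
    rw [ofReal_pow_eq_add_lintegral ha (le_of_lt ht), add_mul]
    congr 1
    rw [lintegral_indicator measurableSet_Iio, Measure.restrict_restrict measurableSet_Iio,
      lintegral_mul_const _ (by fun_prop), inter_comm, Ioi_inter_Iio]
  have hm : Measurable (Function.uncurry fun t s : ℝ =>
      (Iio t).indicator (fun s => ENNReal.ofReal (k * s ^ (k - 1)) * f t) s) := by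
    have : (Function.uncurry fun t s : ℝ =>
      (Iio t).indicator (fun s => ENNReal.ofReal (k * s ^ (k - 1)) * f t) s)
      = indicator {z : ℝ × ℝ | z.2 < z.1}
          (fun z => ENNReal.ofReal (k * z.2 ^ (k - 1)) * f z.1) := by
      ext ⟨t, s⟩; simp [indicator]
    rw [this]
    exact Measurable.indicator (by fun_prop) (measurableSet_lt measurable_snd measurable_fst)
  rw [setLIntegral_congr_fun measurableSet_Ioi h1, lintegral_add_left (by fun_prop),
    lintegral_const_mul _ hf, lintegral_lintegral_swap hm.aemeasurable]
  congr 1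
  refine setLIntegral_congr_fun measurableSet_Ioi fun s hs => ?_
  rw [← lintegral_const_mul _ hf]
  rw [← lintegral_indicator measurableSet_Ioi, ← lintegral_indicator measurableSet_Ioi]
  congr 1; ext t
  have hs' : a < s := hs
  by_cases h : s < t
  · simp [indicator, h, hs'.trans h]
  · simp [indicator, h]

theorem weighted_tail_le_of_tail_le {q₁ q₂ Q : ℝ → ℝ≥0∞} (h₁ : Measurable q₁) (h₂ : Measurable q₂)
    (hQ : Measurable Q)
    (htail : ∀ σ, 0 < σ → (∫⁻ t in Ioi σ, q₁ t) + Q σ ≤ ∫⁻ t in Ioi σ, q₂ t)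
    {k : ℕ} (hk : k ≠ 0) {a : ℝ} (ha : 0 ≤ a) :
    (∫⁻ t in Ioi a, ENNReal.ofReal (t ^ k) * q₁ t)
        + ∫⁻ t in Ioi a, ENNReal.ofReal (k * t ^ (k - 1)) * Q t
      ≤ ∫⁻ t in Ioi a, ENNReal.ofReal (t ^ k) * q₂ t := by
  rw [lintegral_pow_mul_tail h₁ k ha, lintegral_pow_mul_tail h₂ k ha, add_assoc,
    ← lintegral_add_right _ (by fun_prop)]
  refine add_le_add ?_ (setLIntegral_mono' measurableSet_Ioi fun s hs => ?_)
  -- The tail hypothesis is not available at 0, but there `k ≠ 0` kills the boundary term.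
  · rcases ha.eq_or_lt with rfl | ha
    · simp [hk]
    · exact mul_le_mul_right (le_self_add.trans (htail a ha)) _
  · rw [← mul_add]
    exact mul_le_mul_right (htail s (ha.trans_lt hs)) _

theorem exists_ae_eq_Ioi_of_monotoneOn {R : ℝ → ℝ} (hR : MonotoneOn R (Ioi 0)) (s : ℝ) :
    (Ioi (0 : ℝ) ∩ {t | s < R t} = ∅) ∨
      ∃ a, 0 ≤ a ∧ (Ioi (0 : ℝ) ∩ {t | s < R t} : Set ℝ) =ᵐ[volume] Ioi a := by
  set A : Set ℝ := Ioi (0 : ℝ) ∩ {t | s < R t} with hA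
  rcases A.eq_empty_or_nonempty with h | h
  · exact Or.inl h
  refine Or.inr ⟨sInf A, le_csInf h fun t ht => ht.1.le, ?_⟩
  have hb : BddBelow A := ⟨0, fun t ht => ht.1.le⟩
  have h1 : Ioi (sInf A) ⊆ A := by
    intro t ht
    obtain ⟨u, hu, hut⟩ := (csInf_lt_iff hb h).1 ht
    have hu0 : 0 < u := hu.1
    exact ⟨hu0.trans hut, lt_of_lt_of_le hu.2 (hR hu.1 (hu0.trans hut) hut.le)⟩
  have h2 : A ⊆ Ici (sInf A) := fun t ht => csInf_le hb ht
  exact Filter.EventuallyLE.antisymm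
    ((LE.le.eventuallyLE h2).trans Ioi_ae_eq_Ici.symm.le)
    (LE.le.eventuallyLE h1)

theorem lintegral_ofReal_mul_layercake {R : ℝ → ℝ} (hRm : Measurable R) {f : ℝ → ℝ≥0∞}
    (hf : Measurable f) :
    ∫⁻ t in Ioi 0, ENNReal.ofReal (R t) * f t
      = ∫⁻ s in Ioi (0 : ℝ), ∫⁻ t in Ioi (0 : ℝ) ∩ {t | s < R t}, f t := by
  have h1 : ∀ t, ENNReal.ofReal (R t) * f t
      = ∫⁻ s in Ioi (0 : ℝ), {t | s < R t}.indicator f t := by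
    intro t
    have : ∀ s, {t | s < R t}.indicator f t = (Iio (R t)).indicator (fun _ => f t) s := by
      intro s; simp [indicator]
    simp_rw [this]
    rw [lintegral_indicator measurableSet_Iio, Measure.restrict_restrict measurableSet_Iio,
      lintegral_const, Measure.restrict_apply .univ, univ_inter, inter_comm, Ioi_inter_Iio,
      Real.volume_Ioo, sub_zero, mul_comm]
  simp_rw [h1]
  rw [lintegral_lintegral_swap]
  · refine lintegral_congr fun s => ?_
    have hs : MeasurableSet {t | s < R t} := measurableSet_lt measurable_const hRm
    rw [lintegral_indicator hs, Measure.restrict_restrict hs, inter_comm]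
  · have : (Function.uncurry fun t s : ℝ => {t | s < R t}.indicator f t)
      = indicator {z : ℝ × ℝ | z.2 < R z.1} (fun z => f z.1) := by
      ext ⟨t, s⟩; simp [indicator]
    rw [this]
    exact (Measurable.indicator (by fun_prop)
      (measurableSet_lt measurable_snd (by fun_prop))).aemeasurable

/-- By the layer cake formula the positive part of a nondecreasing weight is a mixture of indicators
of half-lines, so the inequality on half-lines suffices. This replaces the derivative of the weight,
which would enter with a favourable sign. -/
theorem monotone_weighted_tail_le {q₁ q₂ Q : ℝ → ℝ≥0∞} (h₁ : Measurable q₁)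
    (h₂ : Measurable q₂) (hQ : Measurable Q)
    (htail : ∀ σ, 0 < σ → (∫⁻ t in Ioi σ, q₁ t) + Q σ ≤ ∫⁻ t in Ioi σ, q₂ t)
    {k : ℕ} (hk : k ≠ 0) {R : ℝ → ℝ} (hRm : Measurable R) (hR : MonotoneOn R (Ioi 0)) :
    (∫⁻ t in Ioi 0, ENNReal.ofReal (R t) * (ENNReal.ofReal (t ^ k) * q₁ t))
        + ∫⁻ t in Ioi 0, ENNReal.ofReal (R t) * (ENNReal.ofReal (k * t ^ (k - 1)) * Q t)
      ≤ ∫⁻ t in Ioi 0, ENNReal.ofReal (R t) * (ENNReal.ofReal (t ^ k) * q₂ t) := by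
  rw [lintegral_ofReal_mul_layercake hRm (by fun_prop),
    lintegral_ofReal_mul_layercake hRm (by fun_prop),
    lintegral_ofReal_mul_layercake hRm (by fun_prop)]
  refine (le_lintegral_add _ _).trans (lintegral_mono fun s => ?_)
  rcases exists_ae_eq_Ioi_of_monotoneOn hR s with h | ⟨a, ha, h⟩
  · simp [h]
  · simp only [setLIntegral_congr h]
    exact weighted_tail_le_of_tail_le h₁ h₂ hQ htail hk ha

/-! ### Radial integration. -/

/-- The norm on `Fin p → ℝ` is the sup norm, so the sphere is the boundary of a cube and `ω ⬝ᵥ ω`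
need not be 1. Only the decomposition into rays matters. -/
theorem lintegral_eq_lintegral_sphere_Ioi {p : ℕ} (hp : p ≠ 0) {f : (Fin p → ℝ) → ℝ≥0∞}
    (hf : Measurable f) :
    ∫⁻ x, f x = ∫⁻ ω : Metric.sphere (0 : Fin p → ℝ) 1, (∫⁻ t in Ioi (0 : ℝ),
      ENNReal.ofReal (t ^ (p - 1)) * f (t • (ω : Fin p → ℝ))) ∂(volume.toSphere) := by
  have : NeZero p := ⟨hp⟩
  have hmp := (volume : Measure (Fin p → ℝ)).measurePreserving_homeomorphUnitSphereProd
  have h1 : ∫⁻ x, f x = ∫⁻ x : ({0}ᶜ : Set (Fin p → ℝ)), f x ∂(volume.comap Subtype.val) := by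
    rw [lintegral_subtype_comap (measurableSet_singleton _).compl f,
      restrict_compl_singleton]
  have hg : Measurable fun z : Metric.sphere (0 : Fin p → ℝ) 1 × Ioi (0 : ℝ) =>
      f ((z.2 : ℝ) • (z.1 : Fin p → ℝ)) := by fun_prop
  have h2 : ∀ x : ({0}ᶜ : Set (Fin p → ℝ)), f x
      = (fun z : Metric.sphere (0 : Fin p → ℝ) 1 × Ioi (0 : ℝ) =>
          f ((z.2 : ℝ) • (z.1 : Fin p → ℝ))) (homeomorphUnitSphereProd (Fin p → ℝ) x) := by
    intro x
    have : (x : Fin p → ℝ) = ((homeomorphUnitSphereProd (Fin p → ℝ)).symm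
      (homeomorphUnitSphereProd (Fin p → ℝ) x) : Fin p → ℝ) := by simp
    conv_lhs => rw [this, homeomorphUnitSphereProd_symm_apply_coe]
  simp_rw [h1, h2]
  rw [hmp.lintegral_comp hg, lintegral_prod _ hg.aemeasurable]
  refine lintegral_congr fun ω => ?_
  rw [Measure.volumeIoiPow, lintegral_withDensity_eq_lintegral_mul _ (by fun_prop) (by fun_prop)]
  have h3 := lintegral_subtype_comap (μ := volume) (measurableSet_Ioi (a := (0 : ℝ)))
    (fun t : ℝ => ENNReal.ofReal (t ^ (p - 1)) * f (t • (ω : Fin p → ℝ)))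
  rw [← h3]
  simp

/-- Along each ray, `t ↦ ‖t ω - μ‖²` is a quadratic polynomial. -/
theorem dotProduct_smul_sub_self {p : ℕ} (ω μ : Fin p → ℝ) (hω : 0 < ω ⬝ᵥ ω) (t : ℝ) :
    (t • ω - μ) ⬝ᵥ (t • ω - μ)
      = (μ ⬝ᵥ μ - (ω ⬝ᵥ μ) ^ 2 / (ω ⬝ᵥ ω)) + (ω ⬝ᵥ ω) * (t - ω ⬝ᵥ μ / (ω ⬝ᵥ ω)) ^ 2 := by
  simp only [sub_dotProduct, dotProduct_sub, smul_dotProduct, dotProduct_smul, smul_eq_mul,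
    dotProduct_comm μ ω]
  field_simp
  ring

/-- A lower bound, by radial integration, for the integral of the inner product of the field
`x ↦ (ρ (F x) / F x) x` with `x - μ`, for `F` positively homogeneous of degree two. -/
theorem radial_field_inequality {p : ℕ} (hp : 3 ≤ p) {F : (Fin p → ℝ) → ℝ} (hF : Measurable F)
    (hF0 : ∀ x, 0 ≤ F x) (hFh : ∀ t : ℝ, 0 < t → ∀ x, F (t • x) = t ^ 2 * F x)
    {ρ : ℝ → ℝ} (hρ : Monotone ρ) (hρ0 : ∀ s, 0 ≤ ρ s) {γ : ℝ → ℝ≥0∞} (hγ : Measurable γ)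
    (μ : Fin p → ℝ) (c : ℝ) :
    (∫⁻ x, ENNReal.ofReal (-(ρ (F x) / F x * (x ⬝ᵥ (x - μ)))) * γ ((x - μ) ⬝ᵥ (x - μ) + c))
        + (p - 2 : ℕ) * ∫⁻ x, ENNReal.ofReal (ρ (F x) / F x) * halfTail γ ((x - μ) ⬝ᵥ (x - μ) + c)
      ≤ ∫⁻ x, ENNReal.ofReal (ρ (F x) / F x * (x ⬝ᵥ (x - μ))) * γ ((x - μ) ⬝ᵥ (x - μ) + c) := by
  have hρm := hρ.measurable
  have hG := measurable_halfTail γ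
  have hdot : Measurable fun x : Fin p → ℝ => x ⬝ᵥ (x - μ) := by
    unfold dotProduct; fun_prop
  have hdot' : Measurable fun x : Fin p → ℝ => (x - μ) ⬝ᵥ (x - μ) := by
    unfold dotProduct; fun_prop
  have hp0 : p ≠ 0 := by omega
  have hnn : ((p - 2 : ℕ) : ℝ≥0∞) ≠ ∞ := by simp
  rw [← lintegral_const_mul' _ _ hnn, lintegral_eq_lintegral_sphere_Ioi hp0 (by fun_prop),
    lintegral_eq_lintegral_sphere_Ioi hp0 (by fun_prop),
    lintegral_eq_lintegral_sphere_Ioi hp0 (by fun_prop)]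
  refine (le_lintegral_add _ _).trans (lintegral_mono fun ω => ?_)
  obtain ⟨ω, hω⟩ := ω
  have hω0 : ω ≠ 0 := by
    rintro rfl; simp at hω
  have ha : 0 < ω ⬝ᵥ ω := by
    have h0 : 0 ≤ ω ⬝ᵥ ω := Finset.sum_nonneg fun i _ => mul_self_nonneg _
    exact lt_of_le_of_ne h0 fun h => hω0 (dotProduct_self_eq_zero.1 h.symm)
  set a := ω ⬝ᵥ ω with ha_def
  set l := ω ⬝ᵥ μ / a with hl
  set b := μ ⬝ᵥ μ - (ω ⬝ᵥ μ) ^ 2 / a + c with hb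
  have hquad : ∀ t : ℝ, (t • ω - μ) ⬝ᵥ (t • ω - μ) + c = b + a * (t - l) ^ 2 := by
    intro t; rw [dotProduct_smul_sub_self ω μ ha]; ring
  have hlin : ∀ t : ℝ, (t • ω) ⬝ᵥ (t • ω - μ) = t * (a * (t - l)) := by
    intro t
    rw [smul_dotProduct, dotProduct_sub, dotProduct_smul, smul_eq_mul, smul_eq_mul, ← ha_def,
      mul_sub a, hl, mul_div_cancel₀ _ ha.ne', mul_comm t a]
  obtain ⟨k, rfl⟩ : ∃ k, p = k + 3 := ⟨p - 3, by omega⟩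
  -- The polar weight t^(p−1), one factor t from the field and t⁻² from 1/F combine to t^(p−2),
  -- whence the exponent `k + 1`; what remains of ρ(F)/F is monotone in t.
  have key := monotone_weighted_tail_le (k := k + 1)
    (q₁ := fun t => ENNReal.ofReal (-(a * (t - l))) * γ (b + a * (t - l) ^ 2))
    (q₂ := fun t => ENNReal.ofReal (a * (t - l)) * γ (b + a * (t - l) ^ 2))
    (Q := fun t => halfTail γ (b + a * (t - l) ^ 2))
    (by fun_prop) (by fun_prop) (by fun_prop)
    (fun σ _ => quadratic_tail_le hγ ha l σ) (by omega)
    (R := fun t => ρ (t ^ 2 * F ω) / F ω) (by fun_prop)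
    (fun s hs t _ hst => div_le_div_of_nonneg_right (hρ (mul_le_mul_of_nonneg_right
      (pow_le_pow_left₀ (le_of_lt hs) hst 2) (hF0 ω))) (hF0 ω))
  have hR0 : ∀ t, 0 ≤ ρ (t ^ 2 * F ω) / F ω := fun t => div_nonneg (hρ0 _) (hF0 _)
  have hscale : ∀ (t y : ℝ) (z : ℝ≥0∞), 0 < t →
      ENNReal.ofReal (t ^ (k + 2)) *
          (ENNReal.ofReal (ρ (t ^ 2 * F ω) / (t ^ 2 * F ω) * (t * y)) * z)
        = ENNReal.ofReal (ρ (t ^ 2 * F ω) / F ω) * (ENNReal.ofReal (t ^ (k + 1)) *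
          (ENNReal.ofReal y * z)) := by
    intro t y z ht
    rw [← mul_assoc, ← mul_assoc, ← mul_assoc, ← mul_assoc, ← ENNReal.ofReal_mul (by positivity),
      ← ENNReal.ofReal_mul (hR0 t),
      ← ENNReal.ofReal_mul (mul_nonneg (hR0 t) (pow_nonneg ht.le _))]
    congr 2
    -- Division by zero gives zero, so a ray with `F ω = 0` contributes nothing to either side.
    rcases eq_or_ne (F ω) 0 with h | h
    · simp [h]
    · field_simp
      try ring
  have hscale' : ∀ (t : ℝ) (z : ℝ≥0∞), 0 < t →
      ENNReal.ofReal (t ^ (k + 2)) * (((k + 1 : ℕ) : ℝ≥0∞) *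
          (ENNReal.ofReal (ρ (t ^ 2 * F ω) / (t ^ 2 * F ω)) * z))
        = ENNReal.ofReal (ρ (t ^ 2 * F ω) / F ω) *
          (ENNReal.ofReal (((k + 1 : ℕ) : ℝ) * t ^ k) * z) := by
    intro t z ht
    rw [← ENNReal.ofReal_natCast, ← mul_assoc, ← mul_assoc, ← mul_assoc,
      ← ENNReal.ofReal_mul (by positivity), ← ENNReal.ofReal_mul (by positivity),
      ← ENNReal.ofReal_mul (hR0 t)]
    congr 2
    rcases eq_or_ne (F ω) 0 with h | h
    · simp [h]
    · field_simp
      ring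
  have e : k + 3 - 2 = k + 1 := by omega
  have e' : k + 3 - 1 = k + 2 := by omega
  rw [e, e']
  refine le_trans (le_of_eq (congrArg₂ _ ?_ ?_)) (key.trans (le_of_eq ?_))
  · refine setLIntegral_congr_fun measurableSet_Ioi fun t ht => ?_
    simp only
    rw [hFh t ht, hlin, hquad, ← hscale t _ _ ht, mul_neg t, mul_neg]
  · refine setLIntegral_congr_fun measurableSet_Ioi fun t ht => ?_
    simp only
    rw [hFh t ht, hquad, hscale' t _ ht]
    rfl
  · refine setLIntegral_congr_fun measurableSet_Ioi fun t ht => ?_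
    simp only
    rw [hFh t ht, hlin, hquad, hscale t _ _ ht]

/-! ### Linear changes of variables. -/

/-- Uniqueness of Haar measure. The factor need not be computed, since it appears on both sides of
each comparison; its being nonzero serves to pull finiteness back. -/
theorem exists_lintegral_comp_linearEquiv {V₁ V₂ : Type*}
    [NormedAddCommGroup V₁] [NormedSpace ℝ V₁] [FiniteDimensional ℝ V₁] [MeasureSpace V₁]
    [BorelSpace V₁] [(volume : Measure V₁).IsAddHaarMeasure]
    [NormedAddCommGroup V₂] [NormedSpace ℝ V₂] [FiniteDimensional ℝ V₂] [MeasureSpace V₂]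
    [BorelSpace V₂] [(volume : Measure V₂).IsAddHaarMeasure] (T : V₁ ≃ₗ[ℝ] V₂) :
    ∃ c : ℝ≥0∞, c ≠ 0 ∧ c ≠ ∞ ∧ ∀ f : V₂ → ℝ≥0∞, Measurable f →
      ∫⁻ y, f y = c * ∫⁻ x, f (T x) := by
  set T' := T.toContinuousLinearEquiv
  have hH : ((volume : Measure V₁).map T').IsAddHaarMeasure :=
    T'.isAddHaarMeasure_map _
  refine ⟨Measure.addHaarScalarFactor volume ((volume : Measure V₁).map T'), ?_, by simp, ?_⟩
  · simpa using (Measure.addHaarScalarFactor_pos_of_isAddHaarMeasure _ _).ne'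
  · intro f hf
    conv_lhs => rw [Measure.isAddLeftInvariant_eq_smul (volume : Measure V₂)
      ((volume : Measure V₁).map T')]
    rw [lintegral_smul_measure, lintegral_map hf T'.continuous.measurable]
    rfl

/-! ### Dilations along a subspace. -/

section Projection

variable {E : Type*} [NormedAddCommGroup E] [InnerProductSpace ℝ E] [FiniteDimensional ℝ E]

/-- The linear map that multiplies the component in `K` by `t` and fixes the one in `Kᗮ`. -/
noncomputable def dilateAlong (K : Submodule ℝ E) (t : ℝ) : E →ₗ[ℝ] E :=
  LinearMap.id + (t - 1) • (K.starProjection : E →ₗ[ℝ] E)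

theorem dilateAlong_apply (K : Submodule ℝ E) (t : ℝ) (u : E) :
    dilateAlong K t u = u + (t - 1) • K.starProjection u := rfl

theorem starProjection_dilateAlong (K : Submodule ℝ E) (t : ℝ) (u : E) :
    K.starProjection (dilateAlong K t u) = t • K.starProjection u := by
  have : K.starProjection (K.starProjection u) = K.starProjection u :=
    K.starProjection_eq_self_iff.2 (K.starProjection_apply_mem u)
  rw [dilateAlong_apply, map_add, map_smul, this, sub_smul, one_smul]
  abel

theorem norm_sq_dilateAlong (K : Submodule ℝ E) (t : ℝ) (u : E) :
    ‖dilateAlong K t u‖ ^ 2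
      = ‖u‖ ^ 2 - ‖K.starProjection u‖ ^ 2 + ‖K.starProjection u‖ ^ 2 * t ^ 2 := by
  have h : inner ℝ u (K.starProjection u) = ‖K.starProjection u‖ ^ 2 := by
    rw [← real_inner_self_eq_norm_sq, K.inner_starProjection_left_eq_right,
      K.starProjection_eq_self_iff.2 (K.starProjection_apply_mem u)]
  rw [dilateAlong_apply, norm_add_sq_real, inner_smul_right, h, norm_smul, mul_pow,
    Real.norm_eq_abs, sq_abs]
  ring

theorem det_dilateAlong (K : Submodule ℝ E) (t : ℝ) :
    LinearMap.det (dilateAlong K t) = t ^ Module.finrank ℝ K := by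
  set e := K.prodEquivOfIsCompl Kᗮ K.isCompl_orthogonal
  have h : dilateAlong K t = e.toLinearMap ∘ₗ
      (LinearMap.prodMap (t • LinearMap.id) LinearMap.id) ∘ₗ e.symm.toLinearMap := by
    refine LinearMap.ext fun u => ?_
    obtain ⟨⟨a, b⟩, rfl⟩ := e.surjective u
    have h1 : K.starProjection (a : E) = a := K.starProjection_eq_self_iff.2 a.2
    have h2 : K.starProjection (b : E) = 0 := K.starProjection_apply_eq_zero_iff.2 b.2
    simp [dilateAlong_apply, e, h1, h2, sub_smul]
    abel
  rw [h, LinearMap.det_conj, LinearMap.det_prodMap, LinearMap.det_smul]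
  simp

variable [MeasurableSpace E] [BorelSpace E] (ν : Measure E) [ν.IsAddHaarMeasure]

theorem lintegral_comp_dilateAlong (K : Submodule ℝ E) {t : ℝ} (ht : 0 < t) {f : E → ℝ≥0∞}
    (hf : Measurable f) :
    ∫⁻ u, f (dilateAlong K t u) ∂ν
      = ENNReal.ofReal (t ^ Module.finrank ℝ K)⁻¹ * ∫⁻ u, f u ∂ν := by
  have hdet : LinearMap.det (dilateAlong K t) ≠ 0 := by
    rw [det_dilateAlong]; positivity
  have hm : Measurable (dilateAlong K t) :=
    (LinearMap.continuous_of_finiteDimensional _).measurable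
  rw [← lintegral_map hf hm, Measure.map_linearMap_addHaar_eq_smul_addHaar ν hdet,
    lintegral_smul_measure, det_dilateAlong, abs_of_pos (by positivity)]
  rfl

/-- Normalizes the weight on the dilation parameter; this is the origin of the factor m + 2 in
`projection_scaling_inequality`. -/
theorem lintegral_Ioi_inv_pow (m : ℕ) :
    ((m + 2 : ℕ) : ℝ≥0∞) * ∫⁻ t in Ioi (1 : ℝ), ENNReal.ofReal (t ^ (m + 3))⁻¹ = 1 := by
  have h1 : ∀ t ∈ Ioi (1 : ℝ), ENNReal.ofReal (t ^ (m + 3))⁻¹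
      = ENNReal.ofReal (t ^ (-(m + 3 : ℕ) : ℝ)) := by
    intro t ht
    have : (0 : ℝ) ≤ t := zero_le_one.trans (le_of_lt ht)
    rw [Real.rpow_neg this, Real.rpow_natCast]
  have hlt : (-(m + 3 : ℕ) : ℝ) < -1 := by push_cast; linarith [(Nat.cast_nonneg m : (0 : ℝ) ≤ m)]
  rw [setLIntegral_congr_fun measurableSet_Ioi h1,
    ← ofReal_integral_eq_lintegral_ofReal (integrableOn_Ioi_rpow_of_lt hlt one_pos),
    integral_Ioi_rpow_of_lt hlt one_pos, ← ENNReal.ofReal_natCast,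
    ← ENNReal.ofReal_mul (by positivity)]
  · rw [Real.one_rpow, ← ENNReal.ofReal_one]
    congr 1
    have : (m : ℝ) + 2 ≠ 0 := by positivity
    push_cast
    rw [show (-((m : ℝ) + 3) + 1) = -(m + 2) by ring, neg_div_neg_eq, mul_one_div_cancel this]
  · filter_upwards [ae_restrict_mem measurableSet_Ioi] with t ht
    exact Real.rpow_nonneg (zero_le_one.trans (le_of_lt ht)) _

/-- With m = dim K and D_t = `dilateAlong K t`, the identity ∫Φ = t^m ∫Φ∘D_t is averaged over t > 1
with density (m + 2)t^(−m−3). For fixed u the t-integral is a half tail, because ‖D_t u‖² is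
quadratic in t, and f only decreases along the dilation. Infinitesimally this is the divergence
theorem for v f(v) P_K u, v = ‖P_K u‖², without the nonpositive term 2v²f'(v). -/
theorem projection_scaling_inequality (K : Submodule ℝ E) {f : ℝ → ℝ≥0∞} (hf : Measurable f)
    (hfa : AntitoneOn f (Ioi 0)) {γ : ℝ → ℝ≥0∞} (hγ : Measurable γ) (c : ℝ) :
    ∫⁻ u, ENNReal.ofReal ((‖K.starProjection u‖ ^ 2) ^ 2) * f (‖K.starProjection u‖ ^ 2)
        * γ (c + ‖u‖ ^ 2) ∂ν
      ≤ ((Module.finrank ℝ K + 2 : ℕ) : ℝ≥0∞) * ∫⁻ u, ENNReal.ofReal (‖K.starProjection u‖ ^ 2)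
        * f (‖K.starProjection u‖ ^ 2) * halfTail γ (c + ‖u‖ ^ 2) ∂ν := by
  set m := Module.finrank ℝ K
  set Φ : E → ℝ≥0∞ := fun u => ENNReal.ofReal ((‖K.starProjection u‖ ^ 2) ^ 2)
    * f (‖K.starProjection u‖ ^ 2) * γ (c + ‖u‖ ^ 2) with hΦ
  have hΦm : Measurable Φ := by fun_prop
  have hpt : ∀ u, ∫⁻ t in Ioi (1 : ℝ), ENNReal.ofReal (t ^ 3)⁻¹ * Φ (dilateAlong K t u)
      ≤ ENNReal.ofReal (‖K.starProjection u‖ ^ 2) * f (‖K.starProjection u‖ ^ 2)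
        * halfTail γ (c + ‖u‖ ^ 2) := by
    intro u
    set v := ‖K.starProjection u‖ ^ 2 with hv
    have hvD : ∀ t, ‖K.starProjection (dilateAlong K t u)‖ ^ 2 = t ^ 2 * v := by
      intro t
      rw [starProjection_dilateAlong, norm_smul, mul_pow, Real.norm_eq_abs, sq_abs]
    rcases (sq_nonneg ‖K.starProjection u‖).eq_or_lt with h0 | hpos
    · have hv0 : v = 0 := h0.symm
      have hΦ0 : ∀ t, Φ (dilateAlong K t u) = 0 := fun t => by
        simp only [hΦ, hvD, hv0]; simp
      simp [hΦ0]
    · rw [← hv] at hpos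
      have hq := lintegral_quadratic_eq_halfTail γ (b := c + ‖u‖ ^ 2 - v) (l := 0) (τ := 1) hpos
        zero_le_one
      simp only [sub_zero, one_pow, mul_one, sub_add_cancel] at hq
      rw [← hq, ← lintegral_const_mul _ (by fun_prop)]
      refine setLIntegral_mono' measurableSet_Ioi fun t ht => ?_
      have ht1 : 1 < t := ht
      have ht0 : 0 < t := one_pos.trans ht1
      have hle : f (t ^ 2 * v) ≤ f v := by
        refine hfa hpos (mul_pos (by positivity) hpos) ?_
        exact le_mul_of_one_le_left hpos.le (one_le_pow₀ ht1.le)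
      have e1 : c + ‖dilateAlong K t u‖ ^ 2 = c + ‖u‖ ^ 2 - v + v * t ^ 2 := by
        rw [norm_sq_dilateAlong]; ring
      simp only [hΦ, hvD, e1]
      calc _ = ENNReal.ofReal ((t ^ 3)⁻¹ * (t ^ 2 * v) ^ 2) * f (t ^ 2 * v)
              * γ (c + ‖u‖ ^ 2 - v + v * t ^ 2) := by
            rw [ENNReal.ofReal_mul (by positivity)]; ring
        _ ≤ ENNReal.ofReal ((t ^ 3)⁻¹ * (t ^ 2 * v) ^ 2) * f v
              * γ (c + ‖u‖ ^ 2 - v + v * t ^ 2) := by gcongr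
        _ = ENNReal.ofReal (v * (v * t)) * f v * γ (c + ‖u‖ ^ 2 - v + v * t ^ 2) := by
            congr 3; field_simp
        _ = _ := by
            rw [ENNReal.ofReal_mul hpos.le]; ring
  have hD : Measurable fun z : E × ℝ => dilateAlong K z.2 z.1 := by
    simp only [dilateAlong_apply]; fun_prop
  calc ∫⁻ u, Φ u ∂ν
      = ((m + 2 : ℕ) : ℝ≥0∞) * ∫⁻ t in Ioi (1 : ℝ), (ENNReal.ofReal (t ^ (m + 3))⁻¹
          * ∫⁻ u, Φ u ∂ν) := by
        rw [lintegral_mul_const _ (by fun_prop), ← mul_assoc, lintegral_Ioi_inv_pow, one_mul]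
    _ = ((m + 2 : ℕ) : ℝ≥0∞) * ∫⁻ t in Ioi (1 : ℝ), (∫⁻ u, ENNReal.ofReal (t ^ 3)⁻¹
          * Φ (dilateAlong K t u) ∂ν) := by
        congr 1
        refine setLIntegral_congr_fun measurableSet_Ioi fun t ht => ?_
        have ht0 : (0 : ℝ) < t := one_pos.trans ht
        rw [lintegral_const_mul' _ _ ENNReal.ofReal_ne_top, lintegral_comp_dilateAlong ν K ht0 hΦm,
          ← mul_assoc, ← ENNReal.ofReal_mul (by positivity), pow_add, mul_inv, mul_comm (t ^ 3)⁻¹]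
    _ = ((m + 2 : ℕ) : ℝ≥0∞) * ∫⁻ u, (∫⁻ t in Ioi (1 : ℝ), ENNReal.ofReal (t ^ 3)⁻¹
          * Φ (dilateAlong K t u)) ∂ν := by
        rw [lintegral_lintegral_swap]
        refine Measurable.aemeasurable ?_
        have h2 : Measurable fun z : ℝ × E => Φ (dilateAlong K z.1 z.2) :=
          hΦm.comp (hD.comp measurable_swap)
        exact Measurable.mul (by fun_prop) h2
    _ ≤ _ := mul_le_mul_right (lintegral_mono hpt) _

end Projection

/-! ### Orthogonal frames and Gram matrices. -/

/-- Completes x/‖x‖ to an orthonormal basis. It is used to rotate x onto the first axis, and with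
the all-ones vector to separate the sample mean from the deviations. -/
theorem exists_orthogonal_mulVec_eq_single {k : ℕ} (x : Fin (k + 1) → ℝ) (hx : x ≠ 0) :
    ∃ Q : Matrix (Fin (k + 1)) (Fin (k + 1)) ℝ, Q * Qᵀ = 1 ∧ Qᵀ * Q = 1 ∧
      Q *ᵥ x = Pi.single 0 (Real.sqrt (x ⬝ᵥ x)) := by
  set y : EuclideanSpace ℝ (Fin (k + 1)) := WithLp.toLp 2 x with hy
  have hy0 : y ≠ 0 := fun h => hx (by
    have := congrArg WithLp.ofLp h
    simpa [hy] using this)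
  have hn : ‖y‖ = Real.sqrt (x ⬝ᵥ x) := by
    rw [EuclideanSpace.norm_eq]
    simp [hy, dotProduct, sq]
  have hnpos : ‖y‖ ≠ 0 := norm_ne_zero_iff.2 hy0
  set e : EuclideanSpace ℝ (Fin (k + 1)) := ‖y‖⁻¹ • y
  have he : ‖e‖ = 1 := by
    rw [norm_smul, norm_inv, norm_norm, inv_mul_cancel₀ hnpos]
  obtain ⟨b, hb⟩ := Orthonormal.exists_orthonormalBasis_extension_of_card_eq (𝕜 := ℝ)
    (E := EuclideanSpace ℝ (Fin (k + 1))) (ι := Fin (k + 1)) (by simp) (v := fun _ => e)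
    (s := {0}) (by
      rw [orthonormal_iff_ite]
      rintro ⟨i, hi⟩ ⟨j, hj⟩
      obtain rfl : i = 0 := hi
      obtain rfl : j = 0 := hj
      simp [he])
  have hb0 : b 0 = e := hb 0 rfl
  have hip : ∀ u v : EuclideanSpace ℝ (Fin (k + 1)), inner ℝ u v = ∑ l, u l * v l := by
    intro u v
    rw [PiLp.inner_apply]
    exact Finset.sum_congr rfl fun l _ => by simp [mul_comm]
  set Q : Matrix (Fin (k + 1)) (Fin (k + 1)) ℝ := fun i j => b i j
  have hQ : Q * Qᵀ = 1 := by
    ext i j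
    rw [mul_apply, one_apply, ← orthonormal_iff_ite.1 b.orthonormal i j, hip]
    rfl
  refine ⟨Q, hQ, mul_eq_one_comm.1 hQ, ?_⟩
  have hye : y = ‖y‖ • b 0 := by
    rw [hb0, smul_smul, mul_inv_cancel₀ hnpos, one_smul]
  ext i
  have : (Q *ᵥ x) i = inner ℝ (b i) y := by rw [hip]; rfl
  rw [this, hye, inner_smul_right, orthonormal_iff_ite.1 b.orthonormal, ← hn]
  by_cases h : i = 0 <;> simp [h, hy]

/-- The upper left entry of the inverse of a Gram matrix is the inverse of the squared distance of
the first vector to the span of the others. -/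
theorem gram_inv_apply_zero {E : Type*} [NormedAddCommGroup E] [InnerProductSpace ℝ E]
    [FiniteDimensional ℝ E] {k : ℕ} (u : E) {A : Fin k → E} (hA : LinearIndependent ℝ A) :
    (gram ℝ (Fin.cons u A : Fin (k + 1) → E))⁻¹ 0 0
      = (‖(Submodule.span ℝ (range A))ᗮ.starProjection u‖ ^ 2)⁻¹ := by
  set W := Submodule.span ℝ (range A)
  set a : Fin (k + 1) → E := Fin.cons u A
  -- If `u` lies in the span, the Gram matrix is singular and both sides are 0 by the convention for
  -- inverses.
  by_cases hu : u ∈ W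
  · have h1 : (gram ℝ a).det = 0 := by
      by_contra h
      have := linearIndependent_of_det_gram_ne_zero h
      exact (linearIndependent_finCons.1 this).2 hu
    rw [Wᗮ.starProjection_apply_eq_zero_iff.2 (W.le_orthogonal_orthogonal hu),
      nonsing_inv_apply_not_isUnit _ (by simp [h1])]
    simp
  · have hli : LinearIndependent ℝ a := linearIndependent_finCons.2 ⟨hA, hu⟩
    have hdet : IsUnit (gram ℝ a).det := (posDef_gram_of_linearIndependent hli).det_pos.ne'.isUnit
    set w := Wᗮ.starProjection u with hw
    have hwW : u - w ∈ W := by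
      rw [hw, W.starProjection_orthogonal_val]; simp
    have hwo : w ∈ Wᗮ := Wᗮ.starProjection_apply_mem u
    have hw0 : w ≠ 0 := fun h => hu (by simpa [h] using hwW)
    obtain ⟨c, hc⟩ := (Submodule.mem_span_range_iff_exists_fun ℝ).1 hwW
    -- Coefficients of the residual `w`. The Gram matrix maps them to the inner products with `w`,
    -- of which only the first is nonzero, so `z` is a multiple of the first column of the inverse.
    set z : Fin (k + 1) → ℝ := Fin.cons 1 (-c)
    have hz : ∑ j, z j • a j = w := by
      rw [Fin.sum_univ_succ]
      simp [z, a, hc]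
    have hgz : gram ℝ a *ᵥ z = Pi.single 0 (‖w‖ ^ 2) := by
      ext i
      have h1 : (gram ℝ a *ᵥ z) i = inner ℝ (a i) w := by
        rw [← hz, inner_sum]
        simp [mulVec, dotProduct, gram_apply, inner_smul_right, mul_comm]
      rw [h1]
      refine Fin.cases ?_ (fun j => ?_) i
      · have : inner ℝ (u - w) w = 0 := W.inner_right_of_mem_orthogonal hwW hwo
        rw [inner_sub_left, sub_eq_zero] at this
        simp [a, this]
      · have : inner ℝ (A j) w = 0 :=
          W.inner_right_of_mem_orthogonal (Submodule.subset_span ⟨j, rfl⟩) hwo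
        simpa [a] using this
    have h2 : z = ‖w‖ ^ 2 • (gram ℝ a)⁻¹ *ᵥ Pi.single 0 1 := by
      have h3 : (gram ℝ a)⁻¹ *ᵥ (gram ℝ a *ᵥ z) = z := by
        rw [mulVec_mulVec, nonsing_inv_mul _ hdet, one_mulVec]
      rw [← h3, hgz]
      ext i
      simp [mul_comm]
    have h4 := congrFun h2 0
    have h5 : ‖w‖ ^ 2 * (gram ℝ a)⁻¹ 0 0 = 1 := by
      simpa [z] using h4.symm
    exact eq_inv_of_mul_eq_one_right h5

theorem gram_inv_eq_zero_of_not_linearIndependent {E : Type*} [NormedAddCommGroup E]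
    [InnerProductSpace ℝ E] {k : ℕ} (u : E) {A : Fin k → E} (hA : ¬ LinearIndependent ℝ A) :
    (gram ℝ (Fin.cons u A : Fin (k + 1) → E))⁻¹ = 0 := by
  refine nonsing_inv_apply_not_isUnit _ fun h => ?_
  exact hA (linearIndependent_finCons.1 (linearIndependent_of_det_gram_ne_zero h.ne_zero)).1

/-! ### Hotelling's statistic. -/

/-- The matrix `∑ₖ uₖ uₖ'`. -/
def crossProducts {n p : ℕ} (U : Fin n → Fin p → ℝ) : Matrix (Fin p) (Fin p) ℝ :=
  ∑ i, vecMulVec (U i) (U i)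

/-- Hotelling's statistic `x' (∑ₖ uₖ uₖ')⁻¹ x`. -/
noncomputable def hotelling {n p : ℕ} (x : Fin p → ℝ) (U : Fin n → Fin p → ℝ) : ℝ :=
  x ⬝ᵥ ((crossProducts U)⁻¹ *ᵥ x)

theorem crossProducts_apply {n p : ℕ} (U : Fin n → Fin p → ℝ) (a b : Fin p) :
    crossProducts U a b = ∑ i, U i a * U i b := by
  simp [crossProducts, Matrix.sum_apply, vecMulVec_apply]

theorem posSemidef_crossProducts {n p : ℕ} (U : Fin n → Fin p → ℝ) :
    (crossProducts U).PosSemidef := by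
  refine posSemidef_sum _ fun i _ => ?_
  simpa using posSemidef_vecMulVec_self_star (U i)

theorem hotelling_nonneg {n p : ℕ} (x : Fin p → ℝ) (U : Fin n → Fin p → ℝ) :
    0 ≤ hotelling x U := by
  simpa [hotelling] using (posSemidef_crossProducts U).inv.dotProduct_mulVec_nonneg x

theorem hotelling_smul {n p : ℕ} (t : ℝ) (x : Fin p → ℝ) (U : Fin n → Fin p → ℝ) :
    hotelling (t • x) U = t ^ 2 * hotelling x U := by
  simp [hotelling, mulVec_smul]
  ring

theorem measurable_hotelling {n p : ℕ} :
    Measurable fun z : (Fin p → ℝ) × (Fin n → Fin p → ℝ) => hotelling z.1 z.2 := by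
  have hS : Continuous fun z : (Fin p → ℝ) × (Fin n → Fin p → ℝ) => crossProducts z.2 := by
    refine continuous_matrix fun a b => ?_
    simp only [crossProducts_apply]
    fun_prop
  have hadj : ∀ a b, Measurable fun z : (Fin p → ℝ) × (Fin n → Fin p → ℝ) =>
      (crossProducts z.2).adjugate a b := fun a b =>
    (hS.matrix_adjugate.matrix_elem a b).measurable
  have hdet : Measurable fun z : (Fin p → ℝ) × (Fin n → Fin p → ℝ) =>
      (crossProducts z.2).det := hS.matrix_det.measurable
  have hinv : ∀ a b, Measurable fun z : (Fin p → ℝ) × (Fin n → Fin p → ℝ) =>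
      (crossProducts z.2)⁻¹ a b := by
    intro a b
    simp only [Matrix.inv_def, Ring.inverse_eq_inv', Matrix.smul_apply, smul_eq_mul]
    exact hdet.inv.mul (hadj a b)
  unfold hotelling
  simp only [dotProduct, mulVec]
  exact Finset.measurable_sum _ fun a _ => ((measurable_pi_apply a).comp measurable_fst).mul
    (Finset.measurable_sum _ fun b _ => (hinv a b).mul ((measurable_pi_apply b).comp measurable_fst))

/-! ### Column coordinates adapted to x, and the scatter inequality. -/

section Columns

variable {n k : ℕ}

/-- The data set whose coordinates in the orthonormal basis given by the rows of `Q` are the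
columns `u, A₁, …, A_k`. -/
noncomputable def ofColumns {Q : Matrix (Fin (k + 1)) (Fin (k + 1)) ℝ} (hQ : Q * Qᵀ = 1)
    (hQ' : Qᵀ * Q = 1) :
    (EuclideanSpace ℝ (Fin n) × (Fin k → EuclideanSpace ℝ (Fin n))) ≃ₗ[ℝ]
      (Fin n → Fin (k + 1) → ℝ) where
  toFun z i := (fun j => (Fin.cons z.1 z.2 : Fin (k + 1) → EuclideanSpace ℝ (Fin n)) j i) ᵥ* Q
  invFun U := (WithLp.toLp 2 fun i => (U i ᵥ* Qᵀ) 0, fun j => WithLp.toLp 2 fun i => (U i ᵥ* Qᵀ) j.succ)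
  map_add' z w := by
    ext i : 1
    simp only [Pi.add_apply, ← add_vecMul]
    congr 1
    ext j
    refine Fin.cases ?_ (fun j => ?_) j <;> simp
  map_smul' t z := by
    ext i : 1
    simp only [Pi.smul_apply, ← smul_vecMul, RingHom.id_apply]
    congr 1
    ext j
    refine Fin.cases ?_ (fun j => ?_) j <;> simp
  left_inv z := by
    simp only [vecMul_vecMul, hQ, vecMul_one]
    simp
  right_inv U := by
    ext i : 1
    have : (fun j => (Fin.cons (WithLp.toLp 2 fun i => (U i ᵥ* Qᵀ) 0)
        (fun j => WithLp.toLp 2 fun i => (U i ᵥ* Qᵀ) j.succ) :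
          Fin (k + 1) → EuclideanSpace ℝ (Fin n)) j i) = U i ᵥ* Qᵀ := by
      ext j
      refine Fin.cases ?_ (fun j => ?_) j <;> simp
    simp only [this, vecMul_vecMul, hQ', vecMul_one]

theorem crossProducts_ofColumns {Q : Matrix (Fin (k + 1)) (Fin (k + 1)) ℝ} (hQ : Q * Qᵀ = 1)
    (hQ' : Qᵀ * Q = 1)
    (z : EuclideanSpace ℝ (Fin n) × (Fin k → EuclideanSpace ℝ (Fin n))) :
    crossProducts (ofColumns hQ hQ' z)
      = Qᵀ * gram ℝ (Fin.cons z.1 z.2 : Fin (k + 1) → EuclideanSpace ℝ (Fin n)) * Q := by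
  set a : Fin (k + 1) → EuclideanSpace ℝ (Fin n) := Fin.cons z.1 z.2 with ha
  set M : Matrix (Fin n) (Fin (k + 1)) ℝ := fun i j => a j i
  have h1 : crossProducts (ofColumns hQ hQ' z) = (M * Q)ᵀ * (M * Q) := by
    ext i j
    rw [crossProducts_apply, mul_apply]
    rfl
  have h2 : gram ℝ a = Mᵀ * M := by
    ext i j
    rw [gram_apply, PiLp.inner_apply, mul_apply]
    exact Finset.sum_congr rfl fun l _ => by
      change inner ℝ (a i l) (a j l) = a i l * a j l
      simp [mul_comm]
  rw [h1, h2, transpose_mul]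
  simp only [Matrix.mul_assoc]

theorem hotelling_ofColumns {Q : Matrix (Fin (k + 1)) (Fin (k + 1)) ℝ} (hQ : Q * Qᵀ = 1)
    (hQ' : Qᵀ * Q = 1) {x : Fin (k + 1) → ℝ} (hx : Q *ᵥ x = Pi.single 0 (Real.sqrt (x ⬝ᵥ x)))
    (z : EuclideanSpace ℝ (Fin n) × (Fin k → EuclideanSpace ℝ (Fin n))) :
    hotelling x (ofColumns hQ hQ' z) = (x ⬝ᵥ x) *
      (gram ℝ (Fin.cons z.1 z.2 : Fin (k + 1) → EuclideanSpace ℝ (Fin n)))⁻¹ 0 0 := by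
  have hx0 : 0 ≤ x ⬝ᵥ x := Finset.sum_nonneg fun i _ => mul_self_nonneg _
  rw [hotelling, crossProducts_ofColumns, Matrix.mul_inv_rev, Matrix.mul_inv_rev, inv_eq_left_inv hQ',
    inv_eq_left_inv hQ, ← mulVec_mulVec, ← mulVec_mulVec, dotProduct_mulVec, vecMul_transpose,
    hx]
  simp
  rw [← mul_assoc, Real.mul_self_sqrt hx0]

theorem sum_dotProduct_ofColumns {Q : Matrix (Fin (k + 1)) (Fin (k + 1)) ℝ} (hQ : Q * Qᵀ = 1)
    (hQ' : Qᵀ * Q = 1)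
    (z : EuclideanSpace ℝ (Fin n) × (Fin k → EuclideanSpace ℝ (Fin n))) :
    ∑ i, ofColumns hQ hQ' z i ⬝ᵥ ofColumns hQ hQ' z i = ∑ j, ‖z.2 j‖ ^ 2 + ‖z.1‖ ^ 2 := by
  have h1 : ∑ i, ofColumns hQ hQ' z i ⬝ᵥ ofColumns hQ hQ' z i
      = (crossProducts (ofColumns hQ hQ' z)).trace := by
    simp [crossProducts, trace_sum, trace_vecMulVec]
  rw [h1, crossProducts_ofColumns, trace_mul_comm, ← Matrix.mul_assoc, hQ, Matrix.one_mul, trace,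
    Fin.sum_univ_succ]
  simp only [diag_apply, gram_apply, Fin.cons_zero, Fin.cons_succ, real_inner_self_eq_norm_sq]
  ring

end Columns

/-- An upper bound, by scaling the residual of the regression of one column on the others, for the
integral of the squared length of the shrinkage term over the scatter. -/
theorem scatter_field_inequality {n k : ℕ} (hkn : k ≤ n) {x : Fin (k + 1) → ℝ} (hx : x ≠ 0)
    {ρ : ℝ → ℝ} (hρ : Monotone ρ) (hρ0 : ∀ s, 0 ≤ ρ s) {γ : ℝ → ℝ≥0∞} (hγ : Measurable γ)
    (c : ℝ) :
    ∫⁻ U : Fin n → Fin (k + 1) → ℝ,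
        ENNReal.ofReal ((ρ (hotelling x U) / hotelling x U) ^ 2 * (x ⬝ᵥ x))
          * γ (c + ∑ i, U i ⬝ᵥ U i)
      ≤ ((n - k + 2 : ℕ) : ℝ≥0∞) * ∫⁻ U : Fin n → Fin (k + 1) → ℝ,
        ENNReal.ofReal (ρ (hotelling x U) ^ 2 / hotelling x U)
          * halfTail γ (c + ∑ i, U i ⬝ᵥ U i) := by
  obtain ⟨Q, hQ, hQ', hQx⟩ := exists_orthogonal_mulVec_eq_single x hx
  have hx0 : 0 < x ⬝ᵥ x := by
    have h0 : 0 ≤ x ⬝ᵥ x := Finset.sum_nonneg fun i _ => mul_self_nonneg _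
    exact lt_of_le_of_ne h0 fun h => hx (dotProduct_self_eq_zero.1 h.symm)
  set T := ofColumns (n := n) hQ hQ' with hT
  have hH : (volume : Measure (EuclideanSpace ℝ (Fin n) ×
      (Fin k → EuclideanSpace ℝ (Fin n)))).IsAddHaarMeasure := Measure.prod.instIsAddHaarMeasure _ _
  obtain ⟨C, -, -, hC⟩ := exists_lintegral_comp_linearEquiv T
  have hρm := hρ.measurable
  have hGm := measurable_halfTail γ
  have hF : Measurable fun U : Fin n → Fin (k + 1) → ℝ => hotelling x U :=
    measurable_hotelling.comp (measurable_const.prodMk measurable_id)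
  have hS : Measurable fun U : Fin n → Fin (k + 1) → ℝ => c + ∑ i, U i ⬝ᵥ U i := by
    unfold dotProduct; fun_prop
  have hTm : Measurable T := T.toContinuousLinearEquiv.continuous.measurable
  rw [hC _ (by fun_prop), hC _ (by fun_prop), mul_left_comm]
  refine mul_le_mul_right ?_ _
  rw [Measure.volume_eq_prod,
    lintegral_prod_symm _ (by fun_prop), lintegral_prod_symm _ (by fun_prop),
    ← lintegral_const_mul' _ _ (by simp)]
  refine lintegral_mono fun A => ?_
  simp only [hT, hotelling_ofColumns hQ hQ' hQx, sum_dotProduct_ofColumns]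
  by_cases hA : LinearIndependent ℝ A
  · obtain ⟨K, hKA⟩ : ∃ K, K = (Submodule.span ℝ (range A))ᗮ := ⟨_, rfl⟩
    have hgram : ∀ u, (gram ℝ (Fin.cons u A : Fin (k + 1) → EuclideanSpace ℝ (Fin n)))⁻¹ 0 0
        = (‖K.starProjection u‖ ^ 2)⁻¹ := by
      intro u; subst hKA; exact gram_inv_apply_zero u hA
    have hK : Module.finrank ℝ K = n - k := by
      rw [hKA]
      have h1 := (Submodule.span ℝ (range A)).finrank_add_finrank_orthogonal
      rw [finrank_span_eq_card hA, finrank_euclideanSpace, Fintype.card_fin, Fintype.card_fin] at h1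
      omega
    simp only [hgram]
    -- With v = ‖P_K u‖² the statistic is ‖x‖²/v, so the integrands are v²f(v) and v f(v) for f(v) =
    -- ρ(‖x‖²/v)²/‖x‖², which is antitone because ρ is monotone and nonnegative.
    have key := projection_scaling_inequality (volume : Measure (EuclideanSpace ℝ (Fin n))) K
      (f := fun v => ENNReal.ofReal (ρ ((x ⬝ᵥ x) * v⁻¹) ^ 2 / (x ⬝ᵥ x))) (by fun_prop)
      (fun v hv w hw hvw => by
        have hv' : 0 < v := hv
        refine ENNReal.ofReal_le_ofReal ?_
        gcongr
        · exact hρ0 _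
        · exact hρ (by gcongr)) hγ (c + ∑ j, ‖A j‖ ^ 2)
    rw [hK] at key
    refine le_trans (le_of_eq ?_) (key.trans (le_of_eq ?_))
    · refine lintegral_congr fun u => ?_
      simp only [add_assoc]
      rw [← ENNReal.ofReal_mul (by positivity)]
      congr 2
      rcases eq_or_ne (‖K.starProjection u‖ ^ 2) 0 with h | h
      · rw [h]; simp
      · field_simp
    · congr 1
      refine lintegral_congr fun u => ?_
      simp only [add_assoc]
      rw [← ENNReal.ofReal_mul (by positivity)]
      congr 2
      rcases eq_or_ne (‖K.starProjection u‖ ^ 2) 0 with h | h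
      · rw [h]; simp
      · field_simp
  -- For dependent columns the inverse is 0 by convention, hence so are the statistic and the
  -- quotients by it; no null-set argument is needed.
  · simp [gram_inv_eq_zero_of_not_linearIndependent _ hA]

/-! ### Bounds for integrability. -/

theorem dotProduct_crossProducts_mulVec {n p : ℕ} (U : Fin n → Fin p → ℝ) (y z : Fin p → ℝ) :
    y ⬝ᵥ (crossProducts U *ᵥ z) = ∑ i, (U i ⬝ᵥ y) * (U i ⬝ᵥ z) := by
  rw [crossProducts, Matrix.sum_mulVec, dotProduct_sum]
  refine Finset.sum_congr rfl fun i _ => ?_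
  rw [vecMulVec_mulVec, dotProduct_smul, dotProduct_comm y]
  simp

theorem dotProduct_sq_le {p : ℕ} (y z : Fin p → ℝ) :
    (y ⬝ᵥ z) ^ 2 ≤ (y ⬝ᵥ y) * (z ⬝ᵥ z) := by
  simpa [dotProduct, sq] using Finset.sum_mul_sq_le_sq_mul_sq Finset.univ y z

/-- With z = S⁻¹x, ‖x‖² = Σ(Uᵢ·x)(Uᵢ·z). Cauchy–Schwarz applies, since Σ(Uᵢ·z)² is the statistic and
Σ(Uᵢ·x)² ≤ ‖x‖² tr S. -/
theorem inv_hotelling_le {n p : ℕ} (x : Fin p → ℝ) (U : Fin n → Fin p → ℝ) :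
    (hotelling x U)⁻¹ ≤ (∑ i, U i ⬝ᵥ U i) / (x ⬝ᵥ x) := by
  have hUU : 0 ≤ ∑ i, U i ⬝ᵥ U i :=
    Finset.sum_nonneg fun i _ => Finset.sum_nonneg fun j _ => mul_self_nonneg _
  have hxx : 0 ≤ x ⬝ᵥ x := Finset.sum_nonneg fun i _ => mul_self_nonneg _
  rcases (hotelling_nonneg x U).eq_or_lt with hF | hF
  · simpa [← hF] using div_nonneg hUU hxx
  have hx : 0 < x ⬝ᵥ x := by
    refine lt_of_le_of_ne hxx fun h => hF.ne' ?_
    simp [hotelling, dotProduct_self_eq_zero.1 h.symm]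
  have hdet : IsUnit (crossProducts U).det := by
    by_contra h
    simp [hotelling, nonsing_inv_apply_not_isUnit _ h] at hF
  set z := (crossProducts U)⁻¹ *ᵥ x with hz
  have hSz : crossProducts U *ᵥ z = x := by
    rw [hz, mulVec_mulVec, mul_nonsing_inv _ hdet, one_mulVec]
  have h1 : x ⬝ᵥ x = ∑ i, (U i ⬝ᵥ x) * (U i ⬝ᵥ z) := by
    rw [← dotProduct_crossProducts_mulVec, hSz]
  have h2 : hotelling x U = ∑ i, (U i ⬝ᵥ z) ^ 2 := by
    have := dotProduct_crossProducts_mulVec U z z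
    rw [hSz, dotProduct_comm] at this
    simpa [hotelling, sq] using this
  have h3 : ∑ i, (U i ⬝ᵥ x) ^ 2 ≤ (∑ i, U i ⬝ᵥ U i) * (x ⬝ᵥ x) := by
    rw [Finset.sum_mul]
    exact Finset.sum_le_sum fun i _ => dotProduct_sq_le _ _
  have h4 : (x ⬝ᵥ x) ^ 2 ≤ (∑ i, U i ⬝ᵥ U i) * (x ⬝ᵥ x) * hotelling x U := by
    rw [h2]
    calc (x ⬝ᵥ x) ^ 2 ≤ (∑ i, (U i ⬝ᵥ x) ^ 2) * ∑ i, (U i ⬝ᵥ z) ^ 2 := by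
          rw [h1]; exact Finset.sum_mul_sq_le_sq_mul_sq _ _ _
      _ ≤ _ := mul_le_mul_of_nonneg_right h3 (Finset.sum_nonneg fun i _ => sq_nonneg _)
  rw [inv_le_iff_one_le_mul₀ hF, div_mul_eq_mul_div, le_div_iff₀ hx, one_mul]
  nlinarith

/-- The sum of the squared entries of a data set. -/
def sumSq {n p : ℕ} (U : Fin n → Fin p → ℝ) : ℝ := ∑ i, U i ⬝ᵥ U i

theorem dotProduct_self_nonneg_real {p : ℕ} (x : Fin p → ℝ) : 0 ≤ x ⬝ᵥ x :=
  Finset.sum_nonneg fun _ _ => mul_self_nonneg _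

theorem sumSq_nonneg {n p : ℕ} (U : Fin n → Fin p → ℝ) : 0 ≤ sumSq U :=
  Finset.sum_nonneg fun _ _ => dotProduct_self_nonneg_real _

theorem measurable_sumSq {n p : ℕ} :
    Measurable (sumSq : (Fin n → Fin p → ℝ) → ℝ) := by
  unfold sumSq dotProduct; fun_prop

theorem measurable_dotProduct {α : Type*} [MeasurableSpace α] {p : ℕ} {f g : α → Fin p → ℝ}
    (hf : Measurable f) (hg : Measurable g) : Measurable fun a => f a ⬝ᵥ g a := by
  unfold dotProduct; fun_prop

/-- The radial inequality for the field x/‖x‖² centred at 0, whose inner product with x is at most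
1; `3 ≤ p` gives p − 2 ≥ 1. -/
theorem lintegral_inv_sq_mul_halfTail_le {p : ℕ} (hp : 3 ≤ p) {γ : ℝ → ℝ≥0∞} (hγ : Measurable γ)
    (c : ℝ) :
    ∫⁻ x : Fin p → ℝ, ENNReal.ofReal (x ⬝ᵥ x)⁻¹ * halfTail γ (x ⬝ᵥ x + c)
      ≤ ∫⁻ x : Fin p → ℝ, γ (x ⬝ᵥ x + c) := by
  have h := radial_field_inequality hp (F := fun x => x ⬝ᵥ x)
    (measurable_dotProduct measurable_id measurable_id)
    dotProduct_self_nonneg_real (fun t _ x => by simp; ring) (ρ := fun _ => 1) monotone_const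
    (fun _ => zero_le_one) hγ 0 c
  simp only [sub_zero] at h
  calc _ ≤ ((p - 2 : ℕ) : ℝ≥0∞) *
          ∫⁻ x : Fin p → ℝ, ENNReal.ofReal (1 / x ⬝ᵥ x) * halfTail γ (x ⬝ᵥ x + c) := by
        simp only [one_div]
        refine le_mul_of_one_le_left zero_le ?_
        exact_mod_cast (by omega : 1 ≤ p - 2)
    _ ≤ _ := le_add_self.trans h
    _ ≤ _ := by
        refine lintegral_mono fun x => ?_
        refine mul_le_of_le_one_left zero_le (ENNReal.ofReal_le_one.2 ?_)
        rw [one_div]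
        exact inv_mul_le_one

/-- If x − μ is shorter than x, ‖x‖⁻² is at most ‖x − μ‖⁻²; otherwise the half tail increases when x
− μ is replaced by x. Each case gives a centred integral, whence the 2. -/
theorem lintegral_inv_sq_mul_halfTail_translate_le {p : ℕ} (hp : 3 ≤ p) {γ : ℝ → ℝ≥0∞}
    (hγ : Measurable γ) (μ : Fin p → ℝ) (c : ℝ) :
    ∫⁻ x : Fin p → ℝ, ENNReal.ofReal (x ⬝ᵥ x)⁻¹ * halfTail γ ((x - μ) ⬝ᵥ (x - μ) + c)
      ≤ 2 * ∫⁻ x : Fin p → ℝ, γ (x ⬝ᵥ x + c) := by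
  have hG := measurable_halfTail γ
  have : NeZero p := ⟨by omega⟩
  have hm : Measurable fun x : Fin p → ℝ => x ⬝ᵥ x :=
    measurable_dotProduct measurable_id measurable_id
  set f : (Fin p → ℝ) → ℝ≥0∞ :=
    fun x => ENNReal.ofReal (x ⬝ᵥ x)⁻¹ * halfTail γ (x ⬝ᵥ x + c) with hf
  have hfm : Measurable f := by fun_prop
  -- At `x = μ` the convention 0⁻¹ = 0 would break the comparison of inverses.
  have hae : ∀ᵐ x : Fin p → ℝ, x ≠ μ := by
    simp [ae_iff]
  calc _ ≤ ∫⁻ x, (f (x - μ) + f x) := by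
        refine lintegral_mono_ae (hae.mono fun x hx => ?_)
        have hpos : 0 < (x - μ) ⬝ᵥ (x - μ) :=
          lt_of_le_of_ne (dotProduct_self_nonneg_real _)
            fun h => hx (sub_eq_zero.1 (dotProduct_self_eq_zero.1 h.symm))
        rcases le_total ((x - μ) ⬝ᵥ (x - μ)) (x ⬝ᵥ x) with h | h
        · refine le_trans ?_ le_self_add
          simp only [hf]
          gcongr
        · refine le_trans ?_ le_add_self
          simp only [hf]
          gcongr
          exact halfTail_antitone γ (by linarith)
    _ = 2 * ∫⁻ x, f x := by
        rw [lintegral_add_right _ hfm, lintegral_sub_right_eq_self f μ, two_mul]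
    _ ≤ _ := mul_le_mul_right (lintegral_inv_sq_mul_halfTail_le hp hγ c) _

/-! ### Domination in canonical coordinates. -/

section Domination

variable {n p : ℕ} {γ : ℝ → ℝ≥0∞} (μ : Fin p → ℝ)

/-- The argument of the density generator at `(x, U)` when the location parameter is `μ`. -/
def radius (μ : Fin p → ℝ) (z : (Fin p → ℝ) × (Fin n → Fin p → ℝ)) : ℝ :=
  (z.1 - μ) ⬝ᵥ (z.1 - μ) + sumSq z.2

theorem measurable_radius : Measurable (radius (n := n) μ) := by
  have := measurable_sumSq (n := n) (p := p)
  have h2 := measurable_dotProduct (p := p)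
    (f := fun z : (Fin p → ℝ) × (Fin n → Fin p → ℝ) => z.1 - μ) (by fun_prop)
    (g := fun z => z.1 - μ) (by fun_prop)
  unfold radius; fun_prop

theorem lintegral_shrinkage_sq_le (hp : 3 ≤ p) (hpn : p ≤ n) (hγ : Measurable γ)
    {ρ : ℝ → ℝ} (hρ : Monotone ρ) (hρ0 : ∀ s, 0 ≤ ρ s) :
    ∫⁻ z : (Fin p → ℝ) × (Fin n → Fin p → ℝ),
        ENNReal.ofReal ((ρ (hotelling z.1 z.2) / hotelling z.1 z.2) ^ 2 * (z.1 ⬝ᵥ z.1))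
          * γ (radius μ z)
      ≤ ((n - p + 3 : ℕ) : ℝ≥0∞) * ∫⁻ z : (Fin p → ℝ) × (Fin n → Fin p → ℝ),
        ENNReal.ofReal (ρ (hotelling z.1 z.2) ^ 2 / hotelling z.1 z.2)
          * halfTail γ (radius μ z) := by
  have hG := measurable_halfTail γ
  have hρm := hρ.measurable
  have hF := measurable_hotelling (n := n) (p := p)
  have hrad := measurable_radius (n := n) μ
  have hx := measurable_dotProduct (p := p)
    (f := fun z : (Fin p → ℝ) × (Fin n → Fin p → ℝ) => z.1) (by fun_prop)
    (g := fun z => z.1) (by fun_prop)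
  rw [Measure.volume_eq_prod, lintegral_prod _ (by fun_prop), lintegral_prod _ (by fun_prop),
    ← lintegral_const_mul' _ _ (by simp)]
  refine lintegral_mono fun x => ?_
  obtain ⟨k, rfl⟩ : ∃ k, p = k + 1 := ⟨p - 1, by omega⟩
  rcases eq_or_ne x 0 with rfl | hx0
  · simp
  · have := scatter_field_inequality (n := n) (by omega) hx0 hρ hρ0 hγ ((x - μ) ⬝ᵥ (x - μ))
    rwa [show n - k + 2 = n - (k + 1) + 3 by omega] at this

/-- Makes the cross term cancellable. By Cauchy–Schwarz it is at most B(‖x‖²/F² + ‖x − μ‖²). The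
scatter inequality with ρ = 1 turns the first summand into 1/F against the half tail; then 1/F ≤
‖U‖²/‖x‖² and the bound for ‖x‖⁻² leave a second moment. -/
theorem lintegral_inner_field_lt_top (hp : 3 ≤ p) (hpn : p ≤ n) (hγ : Measurable γ)
    (hmom : ∫⁻ z : (Fin p → ℝ) × (Fin n → Fin p → ℝ),
      ENNReal.ofReal (radius 0 z) * γ (radius 0 z) < ∞)
    {ψ : (Fin p → ℝ) × (Fin n → Fin p → ℝ) → ℝ} {B : ℝ}
    (hψ : ∀ z, |ψ z| ≤ B * (hotelling z.1 z.2)⁻¹) :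
    ∫⁻ z : (Fin p → ℝ) × (Fin n → Fin p → ℝ),
        ENNReal.ofReal (ψ z * (z.1 ⬝ᵥ (z.1 - μ))) * γ (radius μ z) < ∞ := by
  have hG := measurable_halfTail γ
  have hF := measurable_hotelling (n := n) (p := p)
  have hrad := measurable_radius (n := n) μ
  have hrad0 := measurable_radius (n := n) (0 : Fin p → ℝ)
  have hsum := measurable_sumSq (n := n) (p := p)
  have hx := measurable_dotProduct (p := p)
    (f := fun z : (Fin p → ℝ) × (Fin n → Fin p → ℝ) => z.1) (by fun_prop)
    (g := fun z => z.1) (by fun_prop)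
  have hxμ := measurable_dotProduct (p := p)
    (f := fun z : (Fin p → ℝ) × (Fin n → Fin p → ℝ) => z.1 - μ) (by fun_prop)
    (g := fun z => z.1 - μ) (by fun_prop)
  have hr0 : ∀ z : (Fin p → ℝ) × (Fin n → Fin p → ℝ), radius 0 z = z.1 ⬝ᵥ z.1 + sumSq z.2 := by
    intro z; simp [radius]
  -- the second moments of the two components
  have h1 : ∫⁻ z : (Fin p → ℝ) × (Fin n → Fin p → ℝ),
      ENNReal.ofReal ((z.1 - μ) ⬝ᵥ (z.1 - μ)) * γ (radius μ z) < ∞ := by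
    refine lt_of_le_of_lt ?_ hmom
    rw [Measure.volume_eq_prod, lintegral_prod_symm _ (by fun_prop),
      lintegral_prod_symm _ (by fun_prop)]
    refine lintegral_mono fun U => ?_
    have e := lintegral_sub_right_eq_self (μ := (volume : Measure (Fin p → ℝ)))
      (fun x => ENNReal.ofReal (x ⬝ᵥ x) * γ (x ⬝ᵥ x + sumSq U)) μ
    simp only [radius, sub_zero]
    rw [e]
    refine lintegral_mono fun x => ?_
    gcongr
    exact le_add_of_nonneg_right (sumSq_nonneg U)
  have h2 : ∫⁻ z : (Fin p → ℝ) × (Fin n → Fin p → ℝ),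
      ENNReal.ofReal ((hotelling z.1 z.2)⁻¹ ^ 2 * (z.1 ⬝ᵥ z.1)) * γ (radius μ z) < ∞ := by
    have h3 := lintegral_shrinkage_sq_le μ hp hpn hγ (ρ := fun _ => 1) monotone_const
      (fun _ => zero_le_one)
    simp only [one_div, one_pow] at h3
    refine lt_of_le_of_lt h3 (ENNReal.mul_lt_top (ENNReal.natCast_lt_top _) ?_)
    calc _ ≤ ∫⁻ z : (Fin p → ℝ) × (Fin n → Fin p → ℝ), ENNReal.ofReal (sumSq z.2) *
          (ENNReal.ofReal (z.1 ⬝ᵥ z.1)⁻¹ * halfTail γ (radius μ z)) := by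
          refine lintegral_mono fun z => ?_
          simp only
          rw [← mul_assoc, ← ENNReal.ofReal_mul (sumSq_nonneg _)]
          gcongr
          exact inv_hotelling_le _ _
      _ = ∫⁻ U : Fin n → Fin p → ℝ, ENNReal.ofReal (sumSq U) * ∫⁻ x : Fin p → ℝ,
          (ENNReal.ofReal (x ⬝ᵥ x)⁻¹ * halfTail γ ((x - μ) ⬝ᵥ (x - μ) + sumSq U)) := by
          rw [Measure.volume_eq_prod, lintegral_prod_symm _ (by fun_prop)]
          refine lintegral_congr fun U => ?_
          rw [← lintegral_const_mul' _ _ ENNReal.ofReal_ne_top]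
          rfl
      _ ≤ ∫⁻ U : Fin n → Fin p → ℝ, ENNReal.ofReal (sumSq U) *
          (2 * ∫⁻ x : Fin p → ℝ, γ (x ⬝ᵥ x + sumSq U)) :=
          lintegral_mono fun U => mul_le_mul_right
            (lintegral_inv_sq_mul_halfTail_translate_le hp hγ μ _) _
      _ = 2 * ∫⁻ z : (Fin p → ℝ) × (Fin n → Fin p → ℝ),
          ENNReal.ofReal (sumSq z.2) * γ (radius 0 z) := by
          rw [Measure.volume_eq_prod, lintegral_prod_symm _ (by fun_prop),
            ← lintegral_const_mul' _ _ (by simp)]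
          refine lintegral_congr fun U => ?_
          simp only [hr0]
          rw [lintegral_const_mul' _ _ ENNReal.ofReal_ne_top, mul_left_comm]
      _ < ∞ := by
          refine ENNReal.mul_lt_top (by simp) (lt_of_le_of_lt (lintegral_mono fun z => ?_) hmom)
          gcongr
          rw [hr0]
          exact le_add_of_nonneg_left (dotProduct_self_nonneg_real _)
  refine lt_of_le_of_lt (b := ENNReal.ofReal B * ((∫⁻ z : (Fin p → ℝ) × (Fin n → Fin p → ℝ),
      ENNReal.ofReal ((hotelling z.1 z.2)⁻¹ ^ 2 * (z.1 ⬝ᵥ z.1)) * γ (radius μ z))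
      + ∫⁻ z : (Fin p → ℝ) × (Fin n → Fin p → ℝ),
      ENNReal.ofReal ((z.1 - μ) ⬝ᵥ (z.1 - μ)) * γ (radius μ z))) ?_
    (ENNReal.mul_lt_top ENNReal.ofReal_lt_top (ENNReal.add_lt_top.2 ⟨h2, h1⟩))
  rw [← lintegral_add_left (by fun_prop), ← lintegral_const_mul' _ _ ENNReal.ofReal_ne_top]
  refine lintegral_mono fun z => ?_
  have hFi : 0 ≤ (hotelling z.1 z.2)⁻¹ := inv_nonneg.2 (hotelling_nonneg _ _)
  set f := (hotelling z.1 z.2)⁻¹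
  have ha : 0 ≤ f ^ 2 * (z.1 ⬝ᵥ z.1) :=
    mul_nonneg (sq_nonneg _) (dotProduct_self_nonneg_real _)
  have hb := dotProduct_self_nonneg_real (z.1 - μ)
  simp only
  rw [← add_mul, ← mul_assoc, ← ENNReal.ofReal_add ha hb]
  refine mul_le_mul_left ?_ _
  rcases eq_or_lt_of_le hFi with hf0 | hfpos
  · have : ψ z = 0 := by
      have h : |ψ z| ≤ B * f := hψ z
      rwa [← hf0, mul_zero, abs_nonpos_iff] at h
    simp [this]
  have hB : 0 ≤ B := nonneg_of_mul_nonneg_left ((abs_nonneg _).trans (hψ z)) hfpos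
  rw [← ENNReal.ofReal_mul hB]
  refine ENNReal.ofReal_le_ofReal ((le_abs_self _).trans ?_)
  rw [abs_mul]
  refine (mul_le_mul_of_nonneg_right (hψ z) (abs_nonneg _)).trans ?_
  rw [mul_assoc]
  refine mul_le_mul_of_nonneg_left ?_ hB
  have hcs := dotProduct_sq_le (f • z.1) (z.1 - μ)
  simp only [smul_dotProduct, dotProduct_smul, smul_eq_mul] at hcs
  have e1 : f * |z.1 ⬝ᵥ (z.1 - μ)| = |f * (z.1 ⬝ᵥ (z.1 - μ))| := by
    rw [abs_mul, abs_of_pos hfpos]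
  rw [e1]
  refine abs_le_of_sq_le_sq ?_ (add_nonneg ha hb)
  nlinarith

/-- For a second-order spherical law, Baranchik's shrinkage of `x` has, at every location
parameter `μ`, at most the quadratic risk of `x`. -/
theorem shrinkage_risk_le (hp : 3 ≤ p) (hpn : p ≤ n) (hγ : Measurable γ)
    (hmom : ∫⁻ z : (Fin p → ℝ) × (Fin n → Fin p → ℝ),
      ENNReal.ofReal (radius 0 z) * γ (radius 0 z) < ∞)
    {ρ : ℝ → ℝ} (hρ : Monotone ρ) (hρ0 : ∀ s, 0 ≤ ρ s)
    (hρB : ∀ s, ρ s ≤ 2 * ((p : ℝ) - 2) / ((n : ℝ) - p + 3)) :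
    ∫⁻ z : (Fin p → ℝ) × (Fin n → Fin p → ℝ),
        ENNReal.ofReal (((1 - ρ (hotelling z.1 z.2) / hotelling z.1 z.2) • z.1 - μ) ⬝ᵥ
          ((1 - ρ (hotelling z.1 z.2) / hotelling z.1 z.2) • z.1 - μ)) * γ (radius μ z)
      ≤ ∫⁻ z : (Fin p → ℝ) × (Fin n → Fin p → ℝ),
        ENNReal.ofReal ((z.1 - μ) ⬝ᵥ (z.1 - μ)) * γ (radius μ z) := by
  have hG := measurable_halfTail γ
  have hρm := hρ.measurable
  have hF := measurable_hotelling (n := n) (p := p)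
  have hrad := measurable_radius (n := n) μ
  have hx := measurable_dotProduct (p := p)
    (f := fun z : (Fin p → ℝ) × (Fin n → Fin p → ℝ) => z.1) (by fun_prop)
    (g := fun z => z.1) (by fun_prop)
  have hxμ := measurable_dotProduct (p := p)
    (f := fun z : (Fin p → ℝ) × (Fin n → Fin p → ℝ) => z.1) (by fun_prop)
    (g := fun z => z.1 - μ) (by fun_prop)
  have hxμ' := measurable_dotProduct (p := p)
    (f := fun z : (Fin p → ℝ) × (Fin n → Fin p → ℝ) => z.1 - μ) (by fun_prop)
    (g := fun z => z.1 - μ) (by fun_prop)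
  set ψ : (Fin p → ℝ) × (Fin n → Fin p → ℝ) → ℝ :=
    fun z => ρ (hotelling z.1 z.2) / hotelling z.1 z.2 with hψ
  have hψm : Measurable ψ := by fun_prop
  have hψ0 : ∀ z, 0 ≤ ψ z := fun z => div_nonneg (hρ0 _) (hotelling_nonneg _ _)
  set B := 2 * ((p : ℝ) - 2) / ((n : ℝ) - p + 3)
  have hψB : ∀ z, |ψ z| ≤ B * (hotelling z.1 z.2)⁻¹ := fun z => by
    rw [abs_of_nonneg (hψ0 z)]
    simp only [hψ, div_eq_mul_inv (ρ _)]
    exact mul_le_mul_of_nonneg_right (hρB _) (inv_nonneg.2 (hotelling_nonneg _ _))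
  set Hp := ∫⁻ z, ENNReal.ofReal (ψ z * (z.1 ⬝ᵥ (z.1 - μ))) * γ (radius μ z) with hHp
  set Hm := ∫⁻ z, ENNReal.ofReal (-(ψ z * (z.1 ⬝ᵥ (z.1 - μ)))) * γ (radius μ z) with hHm
  set A := ∫⁻ z, ENNReal.ofReal (ψ z ^ 2 * (z.1 ⬝ᵥ z.1)) * γ (radius μ z) with hA
  set C := ∫⁻ z, ENNReal.ofReal (ψ z) * halfTail γ (radius μ z) with hC
  set R₁ := ∫⁻ z, ENNReal.ofReal (((1 - ψ z) • z.1 - μ) ⬝ᵥ ((1 - ψ z) • z.1 - μ))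
    * γ (radius μ z) with hR₁
  set R₀ := ∫⁻ z : (Fin p → ℝ) × (Fin n → Fin p → ℝ),
    ENNReal.ofReal ((z.1 - μ) ⬝ᵥ (z.1 - μ)) * γ (radius μ z) with hR₀
  have hHp_top : Hp < ∞ := lintegral_inner_field_lt_top μ hp hpn hγ hmom hψB
  have hrad_ineq : Hm + ((p - 2 : ℕ) : ℝ≥0∞) * C ≤ Hp := by
    rw [hHm, hC, hHp, Measure.volume_eq_prod, lintegral_prod_symm _ (by fun_prop),
      lintegral_prod_symm _ (by fun_prop), lintegral_prod_symm _ (by fun_prop),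
      ← lintegral_const_mul' _ _ (by simp)]
    refine (le_lintegral_add _ _).trans (lintegral_mono fun U => ?_)
    exact radial_field_inequality hp (hF.comp (measurable_id.prodMk measurable_const))
      (fun x => hotelling_nonneg x U) (fun t _ x => hotelling_smul t x U) hρ hρ0 hγ μ (sumSq U)
  -- Since ρ²/F = ρψ, this is the upper bound on ρ, in the form (n − p + 3)ρ ≤ 2(p − 2).
  have hAC : A ≤ 2 * (((p - 2 : ℕ) : ℝ≥0∞) * C) := by
    refine (lintegral_shrinkage_sq_le μ hp hpn hγ hρ hρ0).trans ?_
    rw [hC, ← lintegral_const_mul' _ _ (by simp), ← lintegral_const_mul' _ _ (by simp),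
      ← lintegral_const_mul' _ _ (by simp)]
    refine lintegral_mono fun z => ?_
    simp only
    rw [← mul_assoc, ← mul_assoc, ← mul_assoc]
    refine mul_le_mul_left ?_ _
    have e2 : (2 : ℝ≥0∞) = ENNReal.ofReal 2 := by simp
    rw [e2, ← ENNReal.ofReal_natCast, ← ENNReal.ofReal_natCast,
      ← ENNReal.ofReal_mul (by positivity), ← ENNReal.ofReal_mul (by positivity),
      ← ENNReal.ofReal_mul (by positivity)]
    refine ENNReal.ofReal_le_ofReal ?_
    have hpn' : (p : ℝ) ≤ n := by exact_mod_cast hpn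
    have hpos : (0 : ℝ) < (n : ℝ) - p + 3 := by linarith
    have e3 : ρ (hotelling z.1 z.2) ^ 2 / hotelling z.1 z.2 = ρ (hotelling z.1 z.2) * ψ z := by
      simp only [hψ]; ring
    rw [e3]
    push_cast [Nat.cast_sub hpn, Nat.cast_sub (by omega : 2 ≤ p)]
    rw [← mul_assoc]
    refine mul_le_mul_of_nonneg_right ?_ (hψ0 z)
    have := hρB (hotelling z.1 z.2)
    rw [le_div_iff₀ hpos] at this
    linarith
  -- The expanded square, arranged so that every term lies in [0, ∞].
  have hsplit : R₁ + 2 * Hp = R₀ + A + 2 * Hm := by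
    rw [hR₁, hHp, hR₀, hA, hHm, ← lintegral_const_mul' _ _ (by simp),
      ← lintegral_const_mul' _ _ (by simp), ← lintegral_add_right _ (by fun_prop),
      ← lintegral_add_right _ (by fun_prop), ← lintegral_add_right _ (by fun_prop)]
    refine lintegral_congr fun z => ?_
    rw [← mul_assoc, ← mul_assoc, ← add_mul, ← add_mul, ← add_mul]
    congr 1
    have e : ((1 - ψ z) • z.1 - μ) ⬝ᵥ ((1 - ψ z) • z.1 - μ) + 2 * (ψ z * (z.1 ⬝ᵥ (z.1 - μ)))
        = (z.1 - μ) ⬝ᵥ (z.1 - μ) + ψ z ^ 2 * (z.1 ⬝ᵥ z.1) := by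
      simp only [sub_dotProduct, dotProduct_sub, smul_dotProduct, dotProduct_smul, smul_eq_mul,
        dotProduct_comm μ z.1]
      ring
    have n1 := dotProduct_self_nonneg_real ((1 - ψ z) • z.1 - μ)
    have n2 := dotProduct_self_nonneg_real (z.1 - μ)
    have n3 : 0 ≤ ψ z ^ 2 * (z.1 ⬝ᵥ z.1) :=
      mul_nonneg (sq_nonneg _) (dotProduct_self_nonneg_real _)
    have e2 : (2 : ℝ≥0∞) = ENNReal.ofReal 2 := by simp
    rw [← ENNReal.ofReal_add n2 n3, ← e]
    rcases le_total 0 (ψ z * (z.1 ⬝ᵥ (z.1 - μ))) with h | h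
    · rw [ENNReal.ofReal_of_nonpos (neg_nonpos.2 h), mul_zero, add_zero,
        ENNReal.ofReal_add n1 (mul_nonneg zero_le_two h), ENNReal.ofReal_mul zero_le_two, e2]
    · rw [ENNReal.ofReal_of_nonpos h, mul_zero, add_zero, e2, ← ENNReal.ofReal_mul (by norm_num),
        ← ENNReal.ofReal_add (by rw [e]; positivity) (by linarith)]
      congr 1; ring
  have hfin : 2 * (Hm + ((p - 2 : ℕ) : ℝ≥0∞) * C) ≠ ∞ :=
    ENNReal.mul_ne_top (by simp) (hrad_ineq.trans_lt hHp_top).ne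
  refine (ENNReal.add_le_add_iff_right hfin).1 ?_
  calc R₁ + 2 * (Hm + ((p - 2 : ℕ) : ℝ≥0∞) * C) ≤ R₁ + 2 * Hp := by gcongr
    _ = R₀ + A + 2 * Hm := hsplit
    _ ≤ R₀ + 2 * (((p - 2 : ℕ) : ℝ≥0∞) * C) + 2 * Hm := by gcongr
    _ = _ := by ring

end Domination

/-! ### Reflection of the sample mean. -/

theorem isAddHaarMeasure_volume_sample (N p : ℕ) :
    (volume : Measure (Sample N p)).IsAddHaarMeasure :=
  Measure.pi.isAddHaarMeasure (fun _ : Fin N => (volume : Measure (Fin p → ℝ)))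

theorem measurePreserving_of_involutive {E : Type*} [NormedAddCommGroup E] [NormedSpace ℝ E]
    [FiniteDimensional ℝ E] [MeasurableSpace E] [BorelSpace E] (ν : Measure E)
    [ν.IsAddHaarMeasure] (T : E →ₗ[ℝ] E) (hT : Function.Involutive T) :
    MeasurePreserving T ν ν := by
  have h1 : LinearMap.det T * LinearMap.det T = 1 := by
    rw [← LinearMap.det_comp, show T ∘ₗ T = LinearMap.id from LinearMap.ext hT, LinearMap.det_id]
  have h2 : |LinearMap.det T| = 1 := by
    have := abs_mul_abs_self (LinearMap.det T)
    rw [h1] at this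
    nlinarith [abs_nonneg (LinearMap.det T)]
  have h0 : LinearMap.det T ≠ 0 := fun h => by simp [h] at h1
  refine ⟨(LinearMap.continuous_of_finiteDimensional T).measurable, ?_⟩
  rw [Measure.map_linearMap_addHaar_eq_smul_addHaar ν h0, abs_inv, h2]
  simp

section Reflection

variable {N p : ℕ}

/-- The reflection `yᵢ ↦ yᵢ - 2 ȳ` of the sample mean, which fixes the deviations from it. -/
noncomputable def reflectMean : Sample N p →ₗ[ℝ] Sample N p where
  toFun e i := e i - (2 : ℝ) • sampleMean e
  map_add' e f := by
    ext i : 1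
    simp only [sampleMean, Pi.add_apply, Finset.sum_add_distrib, smul_add]
    abel
  map_smul' t e := by
    ext i : 1
    simp only [sampleMean, Pi.smul_apply, ← Finset.smul_sum, RingHom.id_apply, smul_sub]
    rw [smul_comm _ t, smul_comm _ t]

theorem reflectMean_apply (e : Sample N p) (i : Fin N) :
    reflectMean e i = e i - (2 : ℝ) • sampleMean e := rfl

theorem natCast_smul_sampleMean (hN : N ≠ 0) (e : Sample N p) :
    (N : ℝ) • sampleMean e = ∑ i, e i := by
  rw [sampleMean, smul_smul, mul_inv_cancel₀ (by exact_mod_cast hN), one_smul]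

theorem sampleMean_reflectMean (hN : N ≠ 0) (e : Sample N p) :
    sampleMean (reflectMean e) = -sampleMean e := by
  have hN' : (N : ℝ) ≠ 0 := by exact_mod_cast hN
  have : ∑ i, reflectMean e i = -∑ i, e i := by
    simp only [reflectMean_apply, Finset.sum_sub_distrib, Finset.sum_const, Finset.card_univ,
      Fintype.card_fin]
    rw [← Nat.cast_smul_eq_nsmul ℝ, smul_comm, natCast_smul_sampleMean hN, two_smul]
    abel
  rw [sampleMean, this, smul_neg]; rfl

theorem involutive_reflectMean (hN : N ≠ 0) :
    Function.Involutive (reflectMean : Sample N p →ₗ[ℝ] Sample N p) := by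
  intro e
  ext i : 1
  rw [reflectMean_apply, sampleMean_reflectMean hN, reflectMean_apply, smul_neg]
  abel

/-- The corrections −4Nēē' and +4Nēē' cancel. The error density depends on the cross products alone,
so it is invariant. -/
theorem crossProducts_reflectMean (hN : N ≠ 0) (e : Sample N p) :
    crossProducts (reflectMean e) = crossProducts e := by
  ext a b
  rw [crossProducts_apply, crossProducts_apply]
  have ha := congrFun (natCast_smul_sampleMean hN e) a
  have hb := congrFun (natCast_smul_sampleMean hN e) b
  simp only [Pi.smul_apply, smul_eq_mul, Finset.sum_apply] at ha hb
  have : ∀ i, reflectMean e i a * reflectMean e i b = e i a * e i b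
      - (2 * sampleMean e b) * e i a - (2 * sampleMean e a) * e i b
      + 4 * (sampleMean e a * sampleMean e b) := by
    intro i
    simp only [reflectMean_apply, Pi.sub_apply, Pi.smul_apply, smul_eq_mul]
    ring
  simp only [this, Finset.sum_add_distrib, Finset.sum_sub_distrib, ← Finset.mul_sum, ← ha, ← hb,
    Finset.sum_const, Finset.card_univ, Fintype.card_fin, nsmul_eq_mul]
  ring

/-- The density of `errorLaw g V`. -/
noncomputable def errorDensity (g : ℝ → ℝ) (V : Matrix (Fin p) (Fin p) ℝ) (e : Sample N p) :
    ℝ≥0∞ :=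
  ENNReal.ofReal (V.det ^ (-(N : ℝ) / 2) * g (V⁻¹ * crossProducts e).trace)

theorem continuous_crossProducts : Continuous (crossProducts : Sample N p → _) := by
  refine continuous_matrix fun a b => ?_
  simp only [crossProducts_apply]
  fun_prop

theorem measurable_errorDensity {g : ℝ → ℝ} (hg : Measurable g) (V : Matrix (Fin p) (Fin p) ℝ) :
    Measurable (errorDensity (N := N) g V) := by
  have : Continuous fun e : Sample N p => (V⁻¹ * crossProducts e).trace :=
    (continuous_const.matrix_mul continuous_crossProducts).matrix_trace
  exact ((hg.comp this.measurable).const_mul _).ennreal_ofReal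

theorem lintegral_errorLaw {g : ℝ → ℝ} (hg : Measurable g) (V : Matrix (Fin p) (Fin p) ℝ)
    {f : Sample N p → ℝ≥0∞} (hf : Measurable f) :
    ∫⁻ e, f e ∂errorLaw g V = ∫⁻ e, errorDensity g V e * f e :=
  lintegral_withDensity_eq_lintegral_mul _ (measurable_errorDensity hg V) hf

theorem lintegral_errorLaw_reflectMean (hN : N ≠ 0) {g : ℝ → ℝ} (hg : Measurable g)
    (V : Matrix (Fin p) (Fin p) ℝ) {f : Sample N p → ℝ≥0∞} (hf : Measurable f) :
    ∫⁻ e, f (reflectMean e) ∂errorLaw g V = ∫⁻ e, f e ∂errorLaw g V := by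
  have hH := isAddHaarMeasure_volume_sample N p
  have hmp := measurePreserving_of_involutive (volume : Measure (Sample N p)) reflectMean
    (involutive_reflectMean hN)
  have hd := measurable_errorDensity (N := N) hg V
  rw [lintegral_errorLaw hg V hf,
    lintegral_errorLaw hg V (f := fun e => f (reflectMean e)) (hf.comp hmp.measurable),
    ← hmp.lintegral_comp (f := fun e => errorDensity g V e * f e) (hd.mul hf)]
  refine lintegral_congr fun e => ?_
  simp only [errorDensity, crossProducts_reflectMean hN]

end Reflection

/-! ### Lower bound for the maximal risk. -/

section LowerBound

variable {N p : ℕ}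

theorem measurable_sampleMean : Measurable (sampleMean : Sample N p → Fin p → ℝ) := by
  unfold sampleMean; fun_prop

/-- The quadratic loss as a function of the estimation error. -/
noncomputable def quadLoss (N : ℕ) (V : Matrix (Fin p) (Fin p) ℝ) (d : Fin p → ℝ) : ℝ≥0∞ :=
  ENNReal.ofReal (N * (d ⬝ᵥ (V⁻¹ *ᵥ d)))

theorem measurable_quadLoss (V : Matrix (Fin p) (Fin p) ℝ) :
    Measurable (quadLoss N V) := by
  have : Continuous fun d : Fin p → ℝ => d ⬝ᵥ (V⁻¹ *ᵥ d) :=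
    continuous_id.dotProduct (continuous_const.matrix_mulVec continuous_id)
  exact (this.measurable.const_mul _).ennreal_ofReal

/-- The parallelogram law, without the term 2q(a) ≥ 0. -/
theorem two_mul_quadLoss_le {V : Matrix (Fin p) (Fin p) ℝ} (hV : V.PosDef) (a u : Fin p → ℝ) :
    2 * quadLoss N V u ≤ quadLoss N V (a + u) + quadLoss N V (a + -u) := by
  have hq : ∀ d : Fin p → ℝ, 0 ≤ (N : ℝ) * (d ⬝ᵥ (V⁻¹ *ᵥ d)) := fun d =>
    mul_nonneg (Nat.cast_nonneg N) (by simpa using hV.inv.posSemidef.dotProduct_mulVec_nonneg d)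
  have e2 : (2 : ℝ≥0∞) = ENNReal.ofReal 2 := by simp
  rw [quadLoss, quadLoss, quadLoss, ← ENNReal.ofReal_add (hq _) (hq _), e2,
    ← ENNReal.ofReal_mul zero_le_two]
  refine ENNReal.ofReal_le_ofReal ?_
  have := hq a
  simp only [mulVec_add, mulVec_neg, add_dotProduct, dotProduct_add, neg_dotProduct,
    dotProduct_neg]
  linarith

theorem risk_eq_lintegral_errorLaw (g : ℝ → ℝ) {δ : Sample N p → Fin p → ℝ} (hδ : Measurable δ)
    (θ : Fin p → ℝ) (V : Matrix (Fin p) (Fin p) ℝ) :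
    risk g δ θ V = ∫⁻ e, quadLoss N V (δ (fun i => θ + e i) - θ) ∂errorLaw g V := by
  have h1 : Measurable fun y : Sample N p => quadLoss N V (δ y - θ) :=
    (measurable_quadLoss V).comp (hδ.sub_const θ)
  have h2 : Measurable fun (e : Sample N p) (i : Fin N) => θ + e i := by fun_prop
  exact lintegral_map h1 h2

/-- Here x is the observed mean, so the location is x − ē and the estimation error is D + ē, with D
a function of the deviations. Reflection preserves the law, the truncation set and D, so D + ē may
be averaged with D − ē. -/
theorem truncated_loss_le (hN : N ≠ 0) {g : ℝ → ℝ} (hg : Measurable g)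
    {V : Matrix (Fin p) (Fin p) ℝ} (hV : V.PosDef) {δ : Sample N p → Fin p → ℝ}
    (hδ : Measurable δ) (x : Fin p → ℝ) (K : ℝ) :
    ∫⁻ e : Sample N p in sampleMean ⁻¹' Metric.closedBall 0 K,
        quadLoss N V (sampleMean e) ∂errorLaw g V
      ≤ ∫⁻ e in sampleMean ⁻¹' Metric.closedBall 0 K,
        quadLoss N V (δ (fun i => x + (e i - sampleMean e)) - x + sampleMean e) ∂errorLaw g V := by
  have hm := measurable_sampleMean (N := N) (p := p)
  have hB : MeasurableSet (sampleMean ⁻¹' Metric.closedBall (0 : Fin p → ℝ) K : Set (Sample N p)) :=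
    hm Metric.isClosed_closedBall.measurableSet
  have hq := measurable_quadLoss (N := N) V
  set D : Sample N p → Fin p → ℝ := fun e => δ (fun i => x + (e i - sampleMean e)) - x with hD
  have hDm : Measurable D := (hδ.comp (by fun_prop)).sub_const x
  have hDr : ∀ e, D (reflectMean e) = D e := by
    intro e
    simp only [hD]
    congr 2
    ext i : 1
    rw [sampleMean_reflectMean hN, reflectMean_apply, two_smul]
    abel
  rw [← lintegral_indicator hB, ← lintegral_indicator hB]
  set h : Sample N p → ℝ≥0∞ := (sampleMean ⁻¹' Metric.closedBall (0 : Fin p → ℝ) K).indicator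
    fun e => quadLoss N V (D e + sampleMean e)
  have hh : Measurable h := (hq.comp (hDm.add hm)).indicator hB
  have hr : Measurable fun e : Sample N p => h (reflectMean e) :=
    hh.comp (LinearMap.continuous_of_finiteDimensional _).measurable
  refine (ENNReal.mul_le_mul_iff_right (a := 2) (by simp) (by simp)).1 ?_
  calc _ = ∫⁻ e, 2 * (sampleMean ⁻¹' Metric.closedBall (0 : Fin p → ℝ) K).indicator
          (fun e => quadLoss N V (sampleMean e)) e ∂errorLaw g V :=
        (lintegral_const_mul' _ _ (by simp)).symm
    _ ≤ ∫⁻ e, (h e + h (reflectMean e)) ∂errorLaw g V := by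
        refine lintegral_mono fun e => ?_
        by_cases he : e ∈ sampleMean ⁻¹' Metric.closedBall (0 : Fin p → ℝ) K
        · have he' : reflectMean e ∈ sampleMean ⁻¹' Metric.closedBall (0 : Fin p → ℝ) K := by
            simpa [sampleMean_reflectMean hN] using he
          simp only [h, indicator_of_mem he, indicator_of_mem he', hDr,
            sampleMean_reflectMean hN]
          exact two_mul_quadLoss_le hV _ _
        · simp [indicator_of_notMem he]
    _ = 2 * ∫⁻ e, h e ∂errorLaw g V := by
        rw [lintegral_add_left hh, lintegral_errorLaw_reflectMean hN hg V hh, two_mul]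

/-- Integrates over x in the ball of radius τ. After the substitution x = θ + ē, truncation keeps θ
in the ball of radius τ + K, where the risk is at most its supremum. -/
theorem truncated_loss_mul_volume_le (hN : N ≠ 0) {g : ℝ → ℝ} (hg : Measurable g)
    {V : Matrix (Fin p) (Fin p) ℝ} (hV : V.PosDef) [SFinite (errorLaw (N := N) g V)]
    {δ : Sample N p → Fin p → ℝ} (hδ : Measurable δ) (K τ : ℝ) :
    (∫⁻ e : Sample N p in sampleMean ⁻¹' Metric.closedBall 0 K,
        quadLoss N V (sampleMean e) ∂errorLaw g V)
        * volume (Metric.closedBall (0 : Fin p → ℝ) τ)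
      ≤ (⨆ θ, risk g δ θ V) * volume (Metric.closedBall (0 : Fin p → ℝ) (τ + K)) := by
  have hm := measurable_sampleMean (N := N) (p := p)
  have hq := measurable_quadLoss (N := N) V
  set B : Set (Sample N p) := sampleMean ⁻¹' Metric.closedBall (0 : Fin p → ℝ) K
  have hB : MeasurableSet B := hm Metric.isClosed_closedBall.measurableSet
  have hb : ∀ r, MeasurableSet (Metric.closedBall (0 : Fin p → ℝ) r) := fun r =>
    Metric.isClosed_closedBall.measurableSet
  have hj : Measurable fun z : (Fin p → ℝ) × Sample N p =>
      quadLoss N V (δ (fun i => z.1 + (z.2 i - sampleMean z.2)) - z.1 + sampleMean z.2) :=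
    hq.comp (((hδ.comp (by fun_prop)).sub measurable_fst).add (hm.comp measurable_snd))
  have hj' : Measurable fun z : (Fin p → ℝ) × Sample N p =>
      quadLoss N V (δ (fun i => z.1 + z.2 i) - z.1) :=
    hq.comp ((hδ.comp (by fun_prop)).sub measurable_fst)
  calc _ = ∫⁻ _ in Metric.closedBall (0 : Fin p → ℝ) τ,
          (∫⁻ e in B, quadLoss N V (sampleMean e) ∂errorLaw g V) := by
        rw [setLIntegral_const]
    _ ≤ ∫⁻ x in Metric.closedBall (0 : Fin p → ℝ) τ, (∫⁻ e in B,
          quadLoss N V (δ (fun i => x + (e i - sampleMean e)) - x + sampleMean e)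
            ∂errorLaw g V) :=
        lintegral_mono fun x => truncated_loss_le hN hg hV hδ x K
    _ = ∫⁻ e in B, (∫⁻ x in Metric.closedBall (0 : Fin p → ℝ) τ,
          quadLoss N V (δ (fun i => x + (e i - sampleMean e)) - x + sampleMean e))
            ∂errorLaw g V := lintegral_lintegral_swap hj.aemeasurable
    _ ≤ ∫⁻ e in B, (∫⁻ θ in Metric.closedBall (0 : Fin p → ℝ) (τ + K),
          quadLoss N V (δ (fun i => θ + e i) - θ)) ∂errorLaw g V := by
        refine setLIntegral_mono' hB fun e he => ?_
        have he' : ‖sampleMean e‖ ≤ K := by simpa [B] using he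
        rw [← lintegral_indicator (hb _), ← lintegral_indicator (hb _),
          ← lintegral_add_right_eq_self _ (sampleMean e)]
        refine lintegral_mono fun θ => ?_
        by_cases hθ : θ + sampleMean e ∈ Metric.closedBall (0 : Fin p → ℝ) τ
        · have hθ' : θ ∈ Metric.closedBall (0 : Fin p → ℝ) (τ + K) := by
            rw [mem_closedBall_zero_iff] at hθ ⊢
            calc ‖θ‖ = ‖(θ + sampleMean e) - sampleMean e‖ := by rw [add_sub_cancel_right]
              _ ≤ τ + K := (norm_sub_le _ _).trans (add_le_add hθ he')
          rw [indicator_of_mem hθ, indicator_of_mem hθ']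
          refine le_of_eq (congrArg _ ?_)
          have : (fun i => θ + sampleMean e + (e i - sampleMean e)) = fun i => θ + e i := by
            ext i : 1; abel
          rw [this]; abel
        · simp [indicator_of_notMem hθ]
    _ ≤ ∫⁻ e, (∫⁻ θ in Metric.closedBall (0 : Fin p → ℝ) (τ + K),
          quadLoss N V (δ (fun i => θ + e i) - θ)) ∂errorLaw g V := setLIntegral_le_lintegral _ _
    _ = ∫⁻ θ in Metric.closedBall (0 : Fin p → ℝ) (τ + K), (∫⁻ e,
          quadLoss N V (δ (fun i => θ + e i) - θ) ∂errorLaw g V) :=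
        (lintegral_lintegral_swap hj'.aemeasurable).symm
    _ ≤ ∫⁻ _ in Metric.closedBall (0 : Fin p → ℝ) (τ + K), ⨆ θ, risk g δ θ V := by
        refine lintegral_mono fun θ => ?_
        simp only
        rw [← risk_eq_lintegral_errorLaw g hδ]
        exact le_iSup (fun θ => risk g δ θ V) θ
    _ = _ := by rw [setLIntegral_const]

/-- The constant risk of the sample mean is a lower bound for the maximal risk of every
estimator. -/
theorem lintegral_quadLoss_sampleMean_le_iSup_risk (hN : N ≠ 0) {g : ℝ → ℝ} (hg : Measurable g)
    {V : Matrix (Fin p) (Fin p) ℝ} (hV : V.PosDef) [SFinite (errorLaw (N := N) g V)]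
    {δ : Sample N p → Fin p → ℝ} (hδ : Measurable δ) :
    ∫⁻ e, quadLoss N V (sampleMean e) ∂errorLaw (N := N) g V ≤ ⨆ θ, risk g δ θ V := by
  set s := ⨆ θ, risk g δ θ V
  have hK : ∀ K : ℕ, ∫⁻ e in sampleMean ⁻¹' Metric.closedBall 0 (K : ℝ),
      quadLoss N V (sampleMean e) ∂errorLaw (N := N) g V ≤ s := by
    intro K
    set J := ∫⁻ e in sampleMean ⁻¹' Metric.closedBall 0 (K : ℝ),
      quadLoss N V (sampleMean e) ∂errorLaw (N := N) g V
    -- The ratio of the volumes is (1 + K/τ)^p, which tends to 1 as τ → ∞ with K fixed.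
    have hlim : Filter.Tendsto (fun τ : ℝ => s * ENNReal.ofReal ((1 + K * τ⁻¹) ^ p))
        Filter.atTop (nhds (s * ENNReal.ofReal ((1 + K * 0) ^ p))) := by
      refine ENNReal.Tendsto.const_mul (ENNReal.tendsto_ofReal ?_) (Or.inl (by simp))
      exact ((tendsto_inv_atTop_zero.const_mul _).const_add _).pow p
    have hle : J ≤ s * ENNReal.ofReal ((1 + K * 0) ^ p) := by
      refine ge_of_tendsto hlim ((Filter.eventually_gt_atTop 0).mono fun τ hτ => ?_)
      have h := truncated_loss_mul_volume_le hN hg hV hδ K τ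
      rw [Real.volume_pi_closedBall _ hτ.le, Real.volume_pi_closedBall _ (by positivity),
        Fintype.card_fin] at h
      have hpos : 0 < (2 * τ) ^ p := by positivity
      refine (ENNReal.mul_le_mul_iff_left (c := ENNReal.ofReal ((2 * τ) ^ p)) (by simpa using hpos)
        ENNReal.ofReal_ne_top).1 (h.trans (le_of_eq ?_))
      rw [mul_assoc, ← ENNReal.ofReal_mul (by positivity), ← mul_pow]
      congr 3
      field_simp
    simpa using hle
  have hU : (⋃ K : ℕ, (sampleMean ⁻¹' Metric.closedBall 0 (K : ℝ) : Set (Sample N p))) = univ := by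
    rw [← preimage_iUnion, Metric.iUnion_closedBall_nat, preimage_univ]
  rw [← setLIntegral_univ, ← hU, setLIntegral_iUnion_of_directed]
  · exact iSup_le hK
  · refine Monotone.directed_le fun a b hab => preimage_mono ?_
    exact Metric.closedBall_subset_closedBall (by exact_mod_cast hab)

end LowerBound

/-! ### Second moments from the mixture representation. -/

theorem integrable_exp_neg_mul_dotProduct_self (p : ℕ) {b : ℝ} (hb : 0 < b) :
    Integrable fun x : Fin p → ℝ => Real.exp (-b * (x ⬝ᵥ x)) := by
  have h := Integrable.fintype_prod (f := fun (_ : Fin p) (t : ℝ) => Real.exp (-b * t ^ 2))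
    (μ := fun _ => volume) fun _ => integrable_exp_neg_mul_sq hb
  refine h.congr (Filter.Eventually.of_forall fun x => ?_)
  simp only [dotProduct, Finset.mul_sum, Real.exp_sum, sq]

theorem lintegral_dotProduct_self_mul_exp_lt_top (p : ℕ) :
    ∫⁻ x : Fin p → ℝ, ENNReal.ofReal ((x ⬝ᵥ x) * Real.exp (-(x ⬝ᵥ x) / 2)) < ∞ := by
  have h := (integrable_exp_neg_mul_dotProduct_self p (b := 1 / 4) (by norm_num)).const_mul 4
  refine lt_of_le_of_lt (lintegral_mono fun x => ENNReal.ofReal_le_ofReal ?_) h.lintegral_lt_top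
  set u := x ⬝ᵥ x
  have h1 : u ≤ 4 * Real.exp (u / 4) := by linarith [Real.add_one_le_exp (u / 4)]
  calc u * Real.exp (-u / 2) ≤ 4 * Real.exp (u / 4) * Real.exp (-u / 2) := by gcongr
    _ = 4 * Real.exp (-(1 / 4) * u) := by
      rw [mul_assoc, ← Real.exp_add]; congr 2; ring

theorem normalPDF_inv_smul_one {p : ℕ} {t : ℝ} (ht : 0 < t) (x : Fin p → ℝ) :
    normalPDF (t⁻¹ • (1 : Matrix (Fin p) (Fin p) ℝ)) x
      = (Real.sqrt ((2 * Real.pi) ^ p))⁻¹ * Real.sqrt t ^ p * Real.exp (-(t * (x ⬝ᵥ x)) / 2) := by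
  have hinv : (t⁻¹ • (1 : Matrix (Fin p) (Fin p) ℝ))⁻¹ = t • 1 := by
    refine inv_eq_left_inv ?_
    rw [smul_mul_smul_comm, mul_inv_cancel₀ ht.ne', Matrix.one_mul, one_smul]
  rw [normalPDF, hinv, det_smul, det_one, mul_one, Fintype.card_fin, Real.sqrt_mul (by positivity),
    inv_pow, Real.sqrt_inv, mul_inv, inv_inv, smul_mulVec, one_mulVec, dotProduct_smul, smul_eq_mul]
  congr 3
  rw [Real.sqrt_eq_iff_mul_self_eq (by positivity) (by positivity), ← mul_pow,
    Real.mul_self_sqrt ht.le]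

/-- Rescaling by √t shows that the second moment is proportional to t⁻¹, which is why integrability
of t⁻¹ is the relevant condition. -/
theorem lintegral_dotProduct_self_mul_normalPDF {p : ℕ} {t : ℝ} (ht : 0 < t) :
    ∫⁻ x : Fin p → ℝ, ENNReal.ofReal (normalPDF (t⁻¹ • (1 : Matrix (Fin p) (Fin p) ℝ)) x)
        * ENNReal.ofReal (x ⬝ᵥ x)
      = ENNReal.ofReal t⁻¹ * (ENNReal.ofReal (Real.sqrt ((2 * Real.pi) ^ p))⁻¹ *
        ∫⁻ x : Fin p → ℝ, ENNReal.ofReal ((x ⬝ᵥ x) * Real.exp (-(x ⬝ᵥ x) / 2))) := by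
  set f : (Fin p → ℝ) → ℝ≥0∞ := fun x => ENNReal.ofReal ((x ⬝ᵥ x) * Real.exp (-(x ⬝ᵥ x) / 2))
  have hfm : Measurable f := by
    have := measurable_dotProduct (p := p) (f := fun x : Fin p → ℝ => x) (by fun_prop)
      (g := fun x => x) (by fun_prop)
    fun_prop
  have hs : 0 < Real.sqrt t := Real.sqrt_pos.2 ht
  have hscale : ∫⁻ x, f (Real.sqrt t • x) = ENNReal.ofReal (Real.sqrt t ^ p)⁻¹ * ∫⁻ x, f x := by
    rw [← lintegral_map hfm (measurable_const_smul _), Measure.map_addHaar_smul _ hs.ne',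
      lintegral_smul_measure, Module.finrank_fin_fun, abs_of_pos (by positivity)]
    rfl
  have hpt : ∀ x : Fin p → ℝ,
      ENNReal.ofReal (normalPDF (t⁻¹ • (1 : Matrix (Fin p) (Fin p) ℝ)) x) * ENNReal.ofReal (x ⬝ᵥ x)
        = ENNReal.ofReal (t⁻¹ * (Real.sqrt ((2 * Real.pi) ^ p))⁻¹ * Real.sqrt t ^ p)
          * f (Real.sqrt t • x) := by
    intro x
    have e : (Real.sqrt t • x) ⬝ᵥ (Real.sqrt t • x) = t * (x ⬝ᵥ x) := by
      rw [smul_dotProduct, dotProduct_smul, smul_eq_mul, smul_eq_mul, ← mul_assoc,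
        Real.mul_self_sqrt ht.le]
    simp only [f]
    rw [normalPDF_inv_smul_one ht, e, ← ENNReal.ofReal_mul (by positivity),
      ← ENNReal.ofReal_mul (by positivity)]
    congr 1
    field_simp
  simp_rw [hpt]
  rw [lintegral_const_mul' _ _ ENNReal.ofReal_ne_top, hscale, ← mul_assoc, ← mul_assoc,
    ← ENNReal.ofReal_mul (by positivity), ← ENNReal.ofReal_mul (by positivity)]
  congr 2
  field_simp

theorem normalPDF_nonneg {p : ℕ} (V : Matrix (Fin p) (Fin p) ℝ) (x : Fin p → ℝ) :
    0 ≤ normalPDF V x := by unfold normalPDF; positivity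

/-- The subtracted part is nonnegative. No integrability is needed, as a Bochner integral is always
bounded by the lower integral of the norm. -/
theorem ofReal_mixturePDF_le {p : ℕ} (W : SignedMeasure (Ioi (0 : ℝ)))
    (V : Matrix (Fin p) (Fin p) ℝ) (x : Fin p → ℝ) :
    ENNReal.ofReal (mixturePDF W V x) ≤ ∫⁻ t : Ioi (0 : ℝ),
      ENNReal.ofReal (normalPDF ((t : ℝ)⁻¹ • V) x) ∂W.toJordanDecomposition.posPart := by
  have h1 : mixturePDF W V x ≤ ∫ t : Ioi (0 : ℝ), normalPDF ((t : ℝ)⁻¹ • V) x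
      ∂W.toJordanDecomposition.posPart :=
    sub_le_self _ (integral_nonneg fun t => normalPDF_nonneg _ _)
  refine (ENNReal.ofReal_le_ofReal h1).trans ((Real.ofReal_le_enorm _).trans
    ((enorm_integral_le_lintegral_enorm _).trans (le_of_eq ?_)))
  exact lintegral_congr fun t => Real.enorm_of_nonneg (normalPDF_nonneg _ _)

theorem InSubclass.lintegral_dotProduct_self_lt_top {N p : ℕ} {g : ℝ → ℝ}
    {W : SignedMeasure (Ioi (0 : ℝ))} (hW : InSubclass N p g W) (i : Fin N) :
    ∫⁻ e, ENNReal.ofReal (e i ⬝ᵥ e i) ∂errorLaw (N := N) (p := p) g 1 < ∞ := by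
  have hq : Measurable fun x : Fin p → ℝ => x ⬝ᵥ x :=
    measurable_dotProduct measurable_id measurable_id
  set ν := W.toJordanDecomposition.posPart
  set h : (Fin p → ℝ) → Ioi (0 : ℝ) → ℝ≥0∞ := fun x t =>
    ENNReal.ofReal (normalPDF ((t : ℝ)⁻¹ • (1 : Matrix (Fin p) (Fin p) ℝ)) x) with hh
  have hm : Measurable (Function.uncurry h) := by
    have : Function.uncurry h = fun z : (Fin p → ℝ) × Ioi (0 : ℝ) => ENNReal.ofReal
        ((Real.sqrt ((2 * Real.pi) ^ p))⁻¹ * Real.sqrt z.2 ^ p *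
          Real.exp (-((z.2 : ℝ) * (z.1 ⬝ᵥ z.1)) / 2)) := by
      ext ⟨x, t⟩
      simp only [Function.uncurry, hh]
      rw [normalPDF_inv_smul_one t.2]
    rw [this]
    have : Measurable fun z : (Fin p → ℝ) × Ioi (0 : ℝ) => z.1 ⬝ᵥ z.1 := hq.comp measurable_fst
    fun_prop
  have hm' : Measurable fun x => ∫⁻ t, h x t ∂ν := hm.lintegral_prod_right
  have hmap := hW.component_law 1 PosDef.one i
  calc _ = ∫⁻ x, ENNReal.ofReal (x ⬝ᵥ x) ∂(errorLaw (N := N) g 1).map (fun e => e i) :=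
        (lintegral_map hq.ennreal_ofReal (measurable_pi_apply i)).symm
    _ ≤ ∫⁻ x, ENNReal.ofReal (x ⬝ᵥ x) ∂volume.withDensity (fun x => ∫⁻ t, h x t ∂ν) := by
        rw [hmap]
        exact lintegral_mono' (withDensity_mono
          (Filter.Eventually.of_forall fun x => ofReal_mixturePDF_le W 1 x)) le_rfl
    _ = ∫⁻ x, (∫⁻ t, h x t * ENNReal.ofReal (x ⬝ᵥ x) ∂ν) := by
        rw [lintegral_withDensity_eq_lintegral_mul _ hm' hq.ennreal_ofReal]
        refine lintegral_congr fun x => ?_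
        rw [lintegral_mul_const' _ _ ENNReal.ofReal_ne_top]; rfl
    _ = ∫⁻ t, (∫⁻ x, h x t * ENNReal.ofReal (x ⬝ᵥ x)) ∂ν :=
        lintegral_lintegral_swap
          (hm.mul (hq.comp measurable_fst).ennreal_ofReal).aemeasurable
    _ = (∫⁻ t : Ioi (0 : ℝ), ENNReal.ofReal (t : ℝ)⁻¹ ∂ν) *
          (ENNReal.ofReal (Real.sqrt ((2 * Real.pi) ^ p))⁻¹ *
        ∫⁻ x : Fin p → ℝ, ENNReal.ofReal ((x ⬝ᵥ x) * Real.exp (-(x ⬝ᵥ x) / 2))) := by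
        rw [← lintegral_mul_const _ (by fun_prop)]
        exact lintegral_congr fun t => lintegral_dotProduct_self_mul_normalPDF t.2
    _ < ∞ := ENNReal.mul_lt_top hW.integrable_posPart.lintegral_lt_top
        (ENNReal.mul_lt_top ENNReal.ofReal_lt_top (lintegral_dotProduct_self_mul_exp_lt_top p))

theorem trace_crossProducts {n p : ℕ} (U : Fin n → Fin p → ℝ) :
    (crossProducts U).trace = sumSq U := by
  simp [crossProducts, trace_sum, trace_vecMulVec, sumSq]

theorem InSubclass.lintegral_sumSq_lt_top {N p : ℕ} {g : ℝ → ℝ}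
    {W : SignedMeasure (Ioi (0 : ℝ))} (hW : InSubclass N p g W) :
    ∫⁻ e : Sample N p, ENNReal.ofReal (sumSq e) * ENNReal.ofReal (g (sumSq e)) < ∞ := by
  have hm : ∀ i, Measurable fun e : Sample N p => ENNReal.ofReal (e i ⬝ᵥ e i) := fun i =>
    (measurable_dotProduct (measurable_pi_apply i) (measurable_pi_apply i)).ennreal_ofReal
  have h1 : ∫⁻ e : Sample N p, ENNReal.ofReal (sumSq e) * ENNReal.ofReal (g (sumSq e))
      = ∫⁻ e, ∑ i, ENNReal.ofReal (e i ⬝ᵥ e i) ∂errorLaw (N := N) (p := p) g 1 := by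
    rw [lintegral_errorLaw hW.measurable_generator _ (Finset.measurable_sum _ fun i _ => hm i)]
    refine lintegral_congr fun e => ?_
    rw [errorDensity, det_one, Real.one_rpow, one_mul, inv_one, Matrix.one_mul,
      trace_crossProducts, mul_comm, sumSq,
      ENNReal.ofReal_sum_of_nonneg fun i _ => dotProduct_self_nonneg_real _]
  rw [h1, lintegral_finsetSum _ fun i _ => hm i]
  exact ENNReal.sum_lt_top.2 fun i _ => hW.lintegral_dotProduct_self_lt_top i

/-! ### Canonical coordinates. -/

open scoped MatrixOrder in
theorem exists_eq_mul_transpose_of_posDef {p : ℕ} {V : Matrix (Fin p) (Fin p) ℝ} (hV : V.PosDef) :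
    ∃ B : Matrix (Fin p) (Fin p) ℝ, IsUnit B.det ∧ V = B * Bᵀ := by
  obtain ⟨B, hB, h⟩ := CStarAlgebra.isStrictlyPositive_iff_eq_mul_star_self.mp
    hV.isStrictlyPositive
  refine ⟨B, (isUnit_iff_isUnit_det B).1 hB, ?_⟩
  rw [h, star_eq_conjTranspose, conjTranspose_eq_transpose_of_trivial]

section Canonical

variable {n p : ℕ}

/-- The data with coordinates `(x, U)` in the sample space: the rows of the orthogonal matrix `H`
give the mean direction and the directions of the deviations, and `B` is a square root of the
scale matrix. -/
noncomputable def ofCanonical {B : Matrix (Fin p) (Fin p) ℝ} (hB : IsUnit B.det)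
    {H : Matrix (Fin (n + 1)) (Fin (n + 1)) ℝ} (hH : H * Hᵀ = 1) (hH' : Hᵀ * H = 1) :
    ((Fin p → ℝ) × (Fin n → Fin p → ℝ)) ≃ₗ[ℝ] Sample (n + 1) p where
  toFun z i := B *ᵥ ∑ j, H j i • (Fin.cons z.1 z.2 : Fin (n + 1) → Fin p → ℝ) j
  invFun e := (B⁻¹ *ᵥ ∑ i, H 0 i • e i, fun k => B⁻¹ *ᵥ ∑ i, H k.succ i • e i)
  map_add' z w := by
    ext i : 1
    simp only [Pi.add_apply, ← mulVec_add, ← Finset.sum_add_distrib, ← smul_add]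
    congr 1
    refine Finset.sum_congr rfl fun j _ => congrArg _ ?_
    refine Fin.cases ?_ (fun j => ?_) j <;> simp
  map_smul' t z := by
    ext i : 1
    simp only [Pi.smul_apply, ← mulVec_smul, RingHom.id_apply, Finset.smul_sum]
    congr 1
    refine Finset.sum_congr rfl fun j _ => ?_
    rw [smul_comm]
    congr 1
    refine Fin.cases ?_ (fun j => ?_) j <;> simp
  left_inv z := by
    have key : ∀ l, B⁻¹ *ᵥ ∑ i, H l i • (B *ᵥ ∑ j, H j i •
        (Fin.cons z.1 z.2 : Fin (n + 1) → Fin p → ℝ) j)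
        = (Fin.cons z.1 z.2 : Fin (n + 1) → Fin p → ℝ) l := by
      intro l
      simp only [← mulVec_smul, ← mulVec_sum]
      rw [mulVec_mulVec, nonsing_inv_mul _ hB, one_mulVec]
      simp only [Finset.smul_sum, smul_smul]
      rw [Finset.sum_comm]
      simp only [← Finset.sum_smul]
      have : ∀ j, ∑ i, H l i * H j i = if l = j then 1 else 0 := by
        intro j
        rw [← one_apply, ← hH, mul_apply]; rfl
      simp [this]
    refine Prod.ext ?_ (funext fun k => ?_)
    · simpa using key 0
    · simpa using key k.succ
  right_inv e := by
    have h1 : (Fin.cons (B⁻¹ *ᵥ ∑ i, H 0 i • e i) (fun k => B⁻¹ *ᵥ ∑ i, H (Fin.succ k) i • e i) :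
        Fin (n + 1) → Fin p → ℝ) = fun j => B⁻¹ *ᵥ ∑ i, H j i • e i := by
      ext j : 1
      refine Fin.cases ?_ (fun j => ?_) j <;> simp
    ext i : 1
    simp only [h1, ← mulVec_smul, ← mulVec_sum]
    rw [mulVec_mulVec, mul_nonsing_inv _ hB, one_mulVec]
    simp only [Finset.smul_sum, smul_smul]
    rw [Finset.sum_comm]
    simp only [← Finset.sum_smul]
    have : ∀ l, ∑ j, H j i * H j l = if i = l then 1 else 0 := by
      intro l
      rw [← one_apply, ← hH', mul_apply]; rfl
    simp [this]

variable {B : Matrix (Fin p) (Fin p) ℝ} (hB : IsUnit B.det)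
  {H : Matrix (Fin (n + 1)) (Fin (n + 1)) ℝ} (hH : H * Hᵀ = 1) (hH' : Hᵀ * H = 1)

theorem ofCanonical_apply (z : (Fin p → ℝ) × (Fin n → Fin p → ℝ)) (i : Fin (n + 1)) :
    ofCanonical hB hH hH' z i
      = B *ᵥ ∑ j, H j i • (Fin.cons z.1 z.2 : Fin (n + 1) → Fin p → ℝ) j := rfl

theorem crossProducts_ofCanonical (z : (Fin p → ℝ) × (Fin n → Fin p → ℝ)) :
    crossProducts (ofCanonical hB hH hH' z)
      = B * (vecMulVec z.1 z.1 + crossProducts z.2) * Bᵀ := by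
  set c : Fin (n + 1) → Fin p → ℝ := Fin.cons z.1 z.2 with hc
  set M : Matrix (Fin (n + 1)) (Fin p) ℝ := c
  have h1 : vecMulVec z.1 z.1 + crossProducts z.2 = Mᵀ * M := by
    ext a b
    rw [Matrix.add_apply, crossProducts_apply, mul_apply, Fin.sum_univ_succ, vecMulVec_apply]
    rfl
  have h2 : ∀ i, ofCanonical hB hH hH' z i = (Hᵀ * M * Bᵀ) i := by
    intro i
    rw [ofCanonical_apply, ← hc]
    ext a
    rw [Matrix.mul_apply, mulVec, dotProduct]
    refine Finset.sum_congr rfl fun b _ => ?_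
    rw [mul_comm, transpose_apply, mul_apply, Finset.sum_apply]
    rfl
  have h3 : crossProducts (ofCanonical hB hH hH' z) = (Hᵀ * M * Bᵀ)ᵀ * (Hᵀ * M * Bᵀ) := by
    ext a b
    rw [crossProducts_apply, mul_apply]
    simp only [h2, transpose_apply]
  rw [h3, h1]
  simp only [transpose_mul, transpose_transpose, Matrix.mul_assoc]
  rw [← Matrix.mul_assoc H, hH, Matrix.one_mul]

theorem sampleMean_ofCanonical (hH1 : H *ᵥ 1 = Pi.single 0 (Real.sqrt (n + 1)))
    (z : (Fin p → ℝ) × (Fin n → Fin p → ℝ)) :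
    sampleMean (ofCanonical hB hH hH' z) = (Real.sqrt (n + 1))⁻¹ • B *ᵥ z.1 := by
  have h1 : ∀ j, ∑ i, H j i = if j = 0 then Real.sqrt (n + 1) else 0 := by
    intro j
    have := congrFun hH1 j
    simpa [mulVec, dotProduct, Pi.single_apply] using this
  have h2 : (0 : ℝ) < n + 1 := by positivity
  rw [sampleMean]
  simp only [ofCanonical_apply, ← mulVec_sum]
  rw [Finset.sum_comm]
  simp only [← Finset.sum_smul, h1]
  simp only [ite_smul, zero_smul, Finset.sum_ite_eq', Finset.mem_univ, if_true, Fin.cons_zero,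
    mulVec_smul, smul_smul]
  congr 1
  push_cast
  rw [inv_mul_eq_div, div_eq_iff h2.ne', inv_mul_eq_div, Real.div_sqrt]

theorem shift_ofCanonical (hH1 : H *ᵥ 1 = Pi.single 0 (Real.sqrt (n + 1)))
    (μ : Fin p → ℝ) (z : (Fin p → ℝ) × (Fin n → Fin p → ℝ)) :
    ofCanonical hB hH hH' (z + (μ, 0))
      = fun i => (Real.sqrt (n + 1))⁻¹ • B *ᵥ μ + ofCanonical hB hH hH' z i := by
  -- Applying Hᵀ to the hypothesis on `H *ᵥ 1` shows that the first row of `H` is constant.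
  have h0 : ∀ i, H 0 i = (Real.sqrt (n + 1))⁻¹ := by
    intro i
    have h1 : Hᵀ *ᵥ (H *ᵥ 1) = 1 := by rw [mulVec_mulVec, hH', one_mulVec]
    rw [hH1] at h1
    have h2 := congrFun h1 i
    simp at h2
    exact eq_inv_of_mul_eq_one_left h2
  ext i : 1
  rw [map_add, Pi.add_apply, add_comm, ofCanonical_apply _ _ _ (μ, 0), Fin.sum_univ_succ]
  simp [h0, mulVec_smul]

theorem scatter_eq_crossProducts (y : Sample n p) :
    scatter y = crossProducts fun i => y i - sampleMean y := rfl

theorem scatter_eq_sub (hn : n ≠ 0) (y : Sample n p) :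
    scatter y = crossProducts y - (n : ℝ) • vecMulVec (sampleMean y) (sampleMean y) := by
  ext a b
  rw [scatter_eq_crossProducts, Matrix.sub_apply, crossProducts_apply, crossProducts_apply,
    Matrix.smul_apply,    vecMulVec_apply, smul_eq_mul]
  have ha := congrFun (natCast_smul_sampleMean hn y) a
  have hb := congrFun (natCast_smul_sampleMean hn y) b
  simp only [Pi.smul_apply, smul_eq_mul, Finset.sum_apply] at ha hb
  have : ∀ i, (y i - sampleMean y) a * (y i - sampleMean y) b = y i a * y i b
      - sampleMean y b * y i a - sampleMean y a * y i b + sampleMean y a * sampleMean y b := by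
    intro i
    simp only [Pi.sub_apply]
    ring
  simp only [this, Finset.sum_add_distrib, Finset.sum_sub_distrib, ← Finset.mul_sum, ← ha, ← hb,
    Finset.sum_const, Finset.card_univ, Fintype.card_fin, nsmul_eq_mul]
  ring

theorem scatter_ofCanonical (hH1 : H *ᵥ 1 = Pi.single 0 (Real.sqrt (n + 1)))
    (z : (Fin p → ℝ) × (Fin n → Fin p → ℝ)) :
    scatter (ofCanonical hB hH hH' z) = B * crossProducts z.2 * Bᵀ := by
  have h2 : (0 : ℝ) < n + 1 := by positivity
  rw [scatter_eq_sub (Nat.succ_ne_zero n), crossProducts_ofCanonical,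
    sampleMean_ofCanonical hB hH hH' hH1, vecMulVec_smul, smul_vecMulVec, smul_smul, smul_smul,
    Matrix.mul_add, Matrix.add_mul, mul_vecMulVec, vecMulVec_mul, vecMul_transpose]
  have : ((n + 1 : ℕ) : ℝ) * ((Real.sqrt (n + 1))⁻¹ * (Real.sqrt (n + 1))⁻¹) = 1 := by
    rw [← mul_inv, Real.mul_self_sqrt h2.le]; push_cast; exact mul_inv_cancel₀ h2.ne'
  rw [← mul_assoc] at this
  rw [Nat.succ_eq_add_one, this, one_smul, add_sub_cancel_left]

/-- The square root B cancels; the factor 1/(n + 1) comes from the two means, each carrying (n +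
1)^(−1/2). -/
theorem statF_ofCanonical (hH1 : H *ᵥ 1 = Pi.single 0 (Real.sqrt (n + 1)))
    (z : (Fin p → ℝ) × (Fin n → Fin p → ℝ)) :
    statF (ofCanonical hB hH hH' z) = hotelling z.1 z.2 / (n + 1) := by
  have h2 : (0 : ℝ) < n + 1 := by positivity
  have hB' : IsUnit Bᵀ.det := by rwa [det_transpose]
  rw [statF, scatter_ofCanonical hB hH hH' hH1, sampleMean_ofCanonical hB hH hH' hH1,
    Matrix.mul_inv_rev, Matrix.mul_inv_rev, mulVec_smul, smul_dotProduct, dotProduct_smul,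
    ← mulVec_mulVec, ← mulVec_mulVec, mulVec_mulVec _ B⁻¹, nonsing_inv_mul _ hB, one_mulVec,
    ← vecMul_transpose, ← dotProduct_mulVec, mulVec_mulVec, mul_nonsing_inv _ hB', one_mulVec,
    smul_eq_mul, smul_eq_mul, ← mul_assoc, ← mul_inv, Real.mul_self_sqrt h2.le, hotelling,
    div_eq_inv_mul]

theorem quadLoss_smul_mulVec {V : Matrix (Fin p) (Fin p) ℝ} (hV : V = B * Bᵀ) (hB : IsUnit B.det)
    (w : Fin p → ℝ) :
    quadLoss (n + 1) V ((Real.sqrt (n + 1))⁻¹ • B *ᵥ w) = ENNReal.ofReal (w ⬝ᵥ w) := by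
  have h2 : (0 : ℝ) < n + 1 := by positivity
  have hB' : IsUnit Bᵀ.det := by rwa [det_transpose]
  rw [quadLoss, hV, Matrix.mul_inv_rev, mulVec_smul, smul_dotProduct, dotProduct_smul,
    ← mulVec_mulVec, mulVec_mulVec _ B⁻¹, nonsing_inv_mul _ hB, one_mulVec,
    ← vecMul_transpose, ← dotProduct_mulVec, mulVec_mulVec, mul_nonsing_inv _ hB', one_mulVec,
    smul_eq_mul, smul_eq_mul, ← mul_assoc (Real.sqrt _)⁻¹, ← mul_inv, Real.mul_self_sqrt h2.le]
  push_cast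
  rw [mul_inv_cancel_left₀ h2.ne']

theorem errorDensity_ofCanonical {V : Matrix (Fin p) (Fin p) ℝ} (hV : V = B * Bᵀ) (g : ℝ → ℝ)
    (z : (Fin p → ℝ) × (Fin n → Fin p → ℝ)) :
    errorDensity g V (ofCanonical hB hH hH' z)
      = ENNReal.ofReal (V.det ^ (-((n + 1 : ℕ) : ℝ) / 2))
        * ENNReal.ofReal (g (radius 0 z)) := by
  have hB' : IsUnit Bᵀ.det := by rwa [det_transpose]
  have h1 : (V⁻¹ * crossProducts (ofCanonical hB hH hH' z)).trace = radius 0 z := by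
    rw [crossProducts_ofCanonical, hV, Matrix.mul_inv_rev, trace_mul_comm]
    rw [Matrix.mul_assoc, ← Matrix.mul_assoc Bᵀ, mul_nonsing_inv _ hB', Matrix.one_mul,
      trace_mul_comm, ← Matrix.mul_assoc, nonsing_inv_mul _ hB, Matrix.one_mul, trace_add,
      trace_crossProducts, trace_vecMulVec, radius, sub_zero]
  have hdet : 0 ≤ V.det := by
    rw [hV, det_mul, det_transpose]; exact mul_self_nonneg _
  rw [errorDensity, h1, ENNReal.ofReal_mul (Real.rpow_nonneg hdet _)]

end Canonical

/-! ### Risk in canonical coordinates. -/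

section Risk

variable {n p : ℕ}

/-- The constant C collects the Jacobian and the power of the determinant. It is chosen before the
estimator, so two risks are compared through their integrals alone. -/
theorem exists_risk_eq_canonical {V : Matrix (Fin p) (Fin p) ℝ} (hV : V.PosDef) (θ : Fin p → ℝ)
    {g : ℝ → ℝ} (hg : Measurable g) :
    ∃ (T : ((Fin p → ℝ) × (Fin n → Fin p → ℝ)) ≃ₗ[ℝ] Sample (n + 1) p)
      (B : Matrix (Fin p) (Fin p) ℝ) (μ : Fin p → ℝ) (C : ℝ≥0∞),
      (∀ z, sampleMean (T z) = (Real.sqrt (n + 1))⁻¹ • B *ᵥ z.1) ∧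
      (∀ z, statF (T z) = hotelling z.1 z.2 / (n + 1)) ∧
      ∀ δ : Sample (n + 1) p → Fin p → ℝ, Measurable δ →
        ∀ D : (Fin p → ℝ) × (Fin n → Fin p → ℝ) → Fin p → ℝ,
          (∀ z, δ (T z) = (Real.sqrt (n + 1))⁻¹ • B *ᵥ D z) →
          risk g δ θ V = C * ∫⁻ z : (Fin p → ℝ) × (Fin n → Fin p → ℝ),
            ENNReal.ofReal ((D z - μ) ⬝ᵥ (D z - μ)) * ENNReal.ofReal (g (radius μ z)) := by
  obtain ⟨B, hB, hVB⟩ := exists_eq_mul_transpose_of_posDef hV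
  obtain ⟨H, hH, hH', hH1⟩ := exists_orthogonal_mulVec_eq_single (k := n) 1 one_ne_zero
  have h11 : (1 : Fin (n + 1) → ℝ) ⬝ᵥ 1 = n + 1 := by simp
  rw [h11] at hH1
  have hs : Real.sqrt (n + 1) ≠ 0 := (Real.sqrt_pos.2 (by positivity)).ne'
  set T := ofCanonical (n := n) hB hH hH'
  set μ : Fin p → ℝ := Real.sqrt (n + 1) • B⁻¹ *ᵥ θ
  have hμ : (Real.sqrt (n + 1))⁻¹ • B *ᵥ μ = θ := by
    rw [mulVec_smul, smul_smul, inv_mul_cancel₀ hs, one_smul, mulVec_mulVec,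
      mul_nonsing_inv _ hB, one_mulVec]
  have hH₁ : (volume : Measure ((Fin p → ℝ) × (Fin n → Fin p → ℝ))).IsAddHaarMeasure := by
    have := isAddHaarMeasure_volume_sample n p
    exact Measure.prod.instIsAddHaarMeasure _ _
  have hH₂ := isAddHaarMeasure_volume_sample (n + 1) p
  obtain ⟨c, -, -, hc⟩ := exists_lintegral_comp_linearEquiv T
  refine ⟨T, B, μ, c * ENNReal.ofReal (V.det ^ (-((n + 1 : ℕ) : ℝ) / 2)),
    sampleMean_ofCanonical hB hH hH' hH1, statF_ofCanonical hB hH hH' hH1, fun δ hδ D hD => ?_⟩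
  have hm : Measurable fun e : Sample (n + 1) p =>
      quadLoss (n + 1) V (δ (fun i => θ + e i) - θ) :=
    (measurable_quadLoss V).comp ((hδ.comp (by fun_prop)).sub_const θ)
  rw [risk_eq_lintegral_errorLaw g hδ, lintegral_errorLaw hg V hm,
    hc (fun e => errorDensity g V e * quadLoss (n + 1) V (δ (fun i => θ + e i) - θ))
      ((measurable_errorDensity hg V).mul hm), mul_assoc,
    ← lintegral_const_mul' _ _ ENNReal.ofReal_ne_top,
    ← lintegral_sub_right_eq_self (fun z => errorDensity g V (T z) *
      quadLoss (n + 1) V (δ (fun i => θ + T z i) - θ))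
      ((μ, 0) : (Fin p → ℝ) × (Fin n → Fin p → ℝ))]
  congr 1
  refine lintegral_congr fun z => ?_
  have h1 : (fun i => θ + T (z - (μ, 0)) i) = T z := by
    have := shift_ofCanonical hB hH hH' hH1 μ (z - (μ, 0))
    rw [sub_add_cancel, hμ] at this
    exact this.symm
  have h2 : δ (T z) - θ = (Real.sqrt (n + 1))⁻¹ • B *ᵥ (D z - μ) := by
    rw [hD, mulVec_sub, smul_sub, hμ]
  have h3 : radius 0 (z - (μ, 0)) = radius μ z := by simp [radius]
  rw [h1, h2, quadLoss_smul_mulVec hVB hB, errorDensity_ofCanonical hB hH hH' hVB, h3]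
  ring

theorem lintegral_radius_lt_top {g : ℝ → ℝ} {W : SignedMeasure (Ioi (0 : ℝ))}
    (hW : InSubclass (n + 1) p g W) :
    ∫⁻ z : (Fin p → ℝ) × (Fin n → Fin p → ℝ),
      ENNReal.ofReal (radius 0 z) * ENNReal.ofReal (g (radius 0 z)) < ∞ := by
  have hm := hW.lintegral_sumSq_lt_top
  have hg := hW.measurable_generator
  obtain ⟨H, hH, hH', -⟩ := exists_orthogonal_mulVec_eq_single (k := n) 1 one_ne_zero
  have h1 : IsUnit (1 : Matrix (Fin p) (Fin p) ℝ).det := by simp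
  have hH₁ : (volume : Measure ((Fin p → ℝ) × (Fin n → Fin p → ℝ))).IsAddHaarMeasure := by
    have := isAddHaarMeasure_volume_sample n p
    exact Measure.prod.instIsAddHaarMeasure _ _
  have hH₂ := isAddHaarMeasure_volume_sample (n + 1) p
  obtain ⟨c, hc0, -, hc⟩ := exists_lintegral_comp_linearEquiv (ofCanonical (n := n) h1 hH hH')
  have hs := measurable_sumSq (n := n + 1) (p := p)
  rw [hc _ (by fun_prop)] at hm
  have h2 : ∀ z, sumSq (ofCanonical h1 hH hH' z) = radius 0 z := by
    intro z
    rw [← trace_crossProducts, crossProducts_ofCanonical, transpose_one, Matrix.mul_one,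
      Matrix.one_mul, trace_add, trace_crossProducts, trace_vecMulVec, radius, sub_zero]
  simp only [h2] at hm
  exact lt_top_of_mul_ne_top_right hm.ne hc0

end Risk

/-! ### Comparison with the sample mean, and minimaxity. -/

section Baranchik

variable {N p : ℕ}

theorem statF_nonneg (y : Sample N p) : 0 ≤ statF y :=
  hotelling_nonneg (sampleMean y) fun i => y i - sampleMean y

/-- Only the values of r on [0, ∞) are controlled; this extension is monotone on ℝ, hence
measurable. -/
theorem monotone_comp_max_zero {r : ℝ → ℝ} (hr : MonotoneOn r (Ici 0)) :
    Monotone fun s => r (max s 0) := fun _ _ h =>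
  hr (mem_Ici.2 (le_max_right _ _)) (mem_Ici.2 (le_max_right _ _)) (max_le_max_right 0 h)

theorem measurable_baranchik {r : ℝ → ℝ} (hr : MonotoneOn r (Ici 0)) :
    Measurable (baranchik r : Sample N p → Fin p → ℝ) := by
  have hm := measurable_sampleMean (N := N) (p := p)
  have hF : Measurable (statF : Sample N p → ℝ) :=
    measurable_hotelling.comp (hm.prodMk (by fun_prop :
      Measurable fun (y : Sample N p) (i : Fin N) => y i - sampleMean y))
  have hr' := (monotone_comp_max_zero hr).measurable
  have h : (baranchik r : Sample N p → Fin p → ℝ)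
      = fun y => (1 - r (max (statF y) 0) / statF y) • sampleMean y := by
    ext y : 1
    rw [baranchik, max_eq_left (statF_nonneg y)]
  rw [h]
  exact ((measurable_const.sub ((hr'.comp hF).div hF)).smul hm)

theorem risk_sampleMean (hN : N ≠ 0) (g : ℝ → ℝ) (θ : Fin p → ℝ) (V : Matrix (Fin p) (Fin p) ℝ) :
    risk g (sampleMean : Sample N p → Fin p → ℝ) θ V
      = ∫⁻ e, quadLoss N V (sampleMean e) ∂errorLaw (N := N) g V := by
  rw [risk_eq_lintegral_errorLaw g measurable_sampleMean]
  refine lintegral_congr fun e => congrArg _ ?_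
  have hN' : (N : ℝ) ≠ 0 := by exact_mod_cast hN
  simp only [sampleMean, Finset.sum_add_distrib, Finset.sum_const, Finset.card_univ,
    Fintype.card_fin, smul_add]
  rw [← Nat.cast_smul_eq_nsmul ℝ, smul_smul, inv_mul_cancel₀ hN', one_smul, add_sub_cancel_left]

/-- Baranchik's estimator has at most the risk of the sample mean. -/
theorem risk_baranchik_le_risk_sampleMean (hNp : p < N) {g : ℝ → ℝ}
    {W : SignedMeasure (Ioi (0 : ℝ))} (hW : InSubclass N p g W) {r : ℝ → ℝ}
    (hr_nonneg : ∀ x, 0 ≤ x → 0 ≤ r x) (hr_mono : MonotoneOn r (Ici 0))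
    (hr_le : ∀ x, 0 ≤ x → r x ≤ 2 * ((p : ℝ) - 2) / (N * ((N : ℝ) - p + 2)))
    {V : Matrix (Fin p) (Fin p) ℝ} (hV : V.PosDef) (θ : Fin p → ℝ) :
    risk g (baranchik r : Sample N p → Fin p → ℝ) θ V
      ≤ risk g (sampleMean : Sample N p → Fin p → ℝ) θ V := by
  have hNp' : (p : ℝ) < N := by exact_mod_cast hNp
  have hN0 : (0 : ℝ) < N := lt_of_le_of_lt (Nat.cast_nonneg p) hNp'
  have hden : 0 < (N : ℝ) * ((N : ℝ) - p + 2) := by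
    have : 0 < (N : ℝ) - p + 2 := by linarith
    positivity
  -- Otherwise the upper bound at 0 would be negative.
  have hp2 : 2 ≤ p := by
    have h := (hr_nonneg 0 le_rfl).trans (hr_le 0 le_rfl)
    rw [le_div_iff₀ hden, zero_mul] at h
    have : (2 : ℝ) ≤ p := by linarith
    exact_mod_cast this
  -- For p = 2 the bound forces r = 0 and the estimator is the sample mean; the radial argument
  -- needs p ≥ 3.
  rcases hp2.eq_or_lt with rfl | hp3
  · have h0 : ∀ x, 0 ≤ x → r x = 0 := fun x hx =>
      le_antisymm (by simpa using hr_le x hx) (hr_nonneg x hx)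
    have : (baranchik r : Sample N 2 → Fin 2 → ℝ) = sampleMean := by
      ext y : 1
      rw [baranchik, h0 _ (statF_nonneg y), zero_div, sub_zero, one_smul]
    rw [this]
  · obtain ⟨n, rfl⟩ : ∃ n, N = n + 1 := ⟨N - 1, by omega⟩
    have hn : (0 : ℝ) < (n : ℝ) + 1 := by positivity
    obtain ⟨T, B, μ, C, hmean, hstat, hrisk⟩ :=
      exists_risk_eq_canonical (n := n) hV θ hW.measurable_generator
    -- Chosen so that ρ(F)/F = r(F/N)/(F/N) with N = n + 1; the factor N cancels the one in the
    -- bound on r.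
    set ρ : ℝ → ℝ := fun s => (n + 1) * r (max (s / (n + 1)) 0) with hρ
    have hρ_mono : Monotone ρ := fun a b hab =>
      mul_le_mul_of_nonneg_left (monotone_comp_max_zero hr_mono
        (div_le_div_of_nonneg_right hab hn.le)) hn.le
    have hρ0 : ∀ s, 0 ≤ ρ s := fun s => mul_nonneg hn.le (hr_nonneg _ (le_max_right _ _))
    have hρB : ∀ s, ρ s ≤ 2 * ((p : ℝ) - 2) / ((n : ℝ) - p + 3) := fun s => by
      have h := hr_le (max (s / (n + 1)) 0) (le_max_right _ _)
      push_cast at h hden hNp'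
      have h3 : 0 < (n : ℝ) - p + 3 := by linarith
      rw [le_div_iff₀ hden] at h
      rw [le_div_iff₀ h3]
      calc ρ s * ((n : ℝ) - p + 3)
          = r (max (s / (n + 1)) 0) * (((n : ℝ) + 1) * ((n : ℝ) + 1 - p + 2)) := by
            simp only [hρ]; ring
        _ ≤ _ := h
    have hδ : ∀ z, baranchik r (T z) = (Real.sqrt (n + 1))⁻¹ • B *ᵥ
        ((1 - ρ (hotelling z.1 z.2) / hotelling z.1 z.2) • z.1) := by
      intro z
      have h1 : r (statF (T z)) / statF (T z)
          = ρ (hotelling z.1 z.2) / hotelling z.1 z.2 := by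
        have h2 := statF_nonneg (T z)
        rw [hstat] at h2 ⊢
        simp only [hρ]
        rw [max_eq_left h2, div_div_eq_mul_div, mul_comm]
      rw [baranchik, h1, hmean, mulVec_smul, smul_comm]
    rw [hrisk _ (measurable_baranchik hr_mono) _ hδ, hrisk _ measurable_sampleMean _ hmean]
    refine mul_le_mul_right ?_ _
    exact shrinkage_risk_le μ hp3 (by omega) hW.measurable_generator.ennreal_ofReal
      (lintegral_radius_lt_top hW) hρ_mono hρ0 hρB

end Baranchik

end EllipticalLocation

theorem theorem3p1 (N p : ℕ) (hNp : p < N)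
    (g : ℝ → ℝ) (W : MeasureTheory.SignedMeasure (Set.Ioi (0 : ℝ)))
    (hW : EllipticalLocation.InSubclass N p g W)
    (r : ℝ → ℝ)
    (hr_nonneg : ∀ x, 0 ≤ x → 0 ≤ r x)
    (hr_ac : ∀ b, 0 ≤ b → AbsolutelyContinuousOnInterval r 0 b)
    (hr_mono : MonotoneOn r (Set.Ici 0))
    (hr_le : ∀ x, 0 ≤ x → r x ≤ 2 * ((p : ℝ) - 2) / (N * ((N : ℝ) - p + 2))) :
    (∀ V : Matrix (Fin p) (Fin p) ℝ, V.PosDef →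
      EllipticalLocation.IsMinimax (N := N)
        (fun δ (θ : Fin p → ℝ) => EllipticalLocation.risk g δ θ V)
        (EllipticalLocation.baranchik r)) ∧
    EllipticalLocation.IsMinimax (N := N)
      (fun δ (ϑ : (Fin p → ℝ) × {V : Matrix (Fin p) (Fin p) ℝ // V.PosDef}) =>
        EllipticalLocation.risk g δ ϑ.1 ϑ.2.1)
      (EllipticalLocation.baranchik r) := by
  have hN : N ≠ 0 := by omega
  have hmeas := EllipticalLocation.measurable_baranchik (N := N) (p := p) hr_mono
  have key : ∀ V : Matrix (Fin p) (Fin p) ℝ, V.PosDef →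
      ∀ δ : EllipticalLocation.Sample N p → Fin p → ℝ, Measurable δ → ∀ θ,
        EllipticalLocation.risk (N := N) g (EllipticalLocation.baranchik r) θ V
          ≤ ⨆ θ, EllipticalLocation.risk g δ θ V := by
    intro V hV δ hδ θ
    have := hW.isProbabilityMeasure V hV
    refine (EllipticalLocation.risk_baranchik_le_risk_sampleMean hNp hW hr_nonneg hr_mono hr_le
      hV θ).trans ?_
    rw [EllipticalLocation.risk_sampleMean hN]
    exact EllipticalLocation.lintegral_quadLoss_sampleMean_le_iSup_risk hN
      hW.measurable_generator hV hδ
  refine ⟨fun V hV => ⟨hmeas, fun δ hδ => iSup_le (key V hV δ hδ)⟩, hmeas, fun δ hδ => ?_⟩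
  -- For pairs, the lower bound is applied at the same scale matrix, and the supremum over θ is then
  -- enlarged to all pairs.
  refine iSup_le fun ϑ => (key ϑ.2.1 ϑ.2.2 δ hδ ϑ.1).trans (iSup_le fun θ => ?_)
  exact le_iSup (fun ϑ : (Fin p → ℝ) × {V : Matrix (Fin p) (Fin p) ℝ // V.PosDef} =>
    EllipticalLocation.risk g δ ϑ.1 ϑ.2.1) (θ, ϑ.2)
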